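/- Let $\Omega$ be the upper unit hemisphere with spherical coordinates $\theta\in[0,\pi/2]$, $\varphi\in(-\pi,\pi]$ (the equator $\partial\Omega$ being $\theta=\pi/2$), and let $L^2(\Omega)$ be taken with respect to the surface measure $\sin\theta\,d\theta\,d\varphi$. For integers $\ell\ge 0$ and $|m|\le \ell$ let $$Y_\ell^m(\theta,\varphi)=\sqrt{\frac{2\ell+1}{2\pi}\frac{(\ell-m)!}{(\ell+m)!}}\;P_\ell^m(\cos\theta)\,e^{im\varphi},$$ where $P_\ell^m$ are the associated Legendre functions, and let $\mathcal H_\ell\subset L^2(\Omega)$ be the $(\ell+1)$-dimensional subspace spanned by $Y_\ell^m$, $m=-\ell,-\ell+2,\dots,\ell-2,\ell$ (the eigenspace of the Neumann Laplacian on $\Omega$ for the eigenvalue $\ell(\ell+1)$). Let $\sigma$ be a real-valued $C^1$-smooth function on the equator, regarded as a $2\pi$-periodic $C^1$ function on $\mathbb R$, and let $\sigma_{\rm even}(\varphi)=\frac12(\sigma(\varphi)+\sigma(\varphi+\pi))$. Let $V_\ell[\sigma]$ be the self-adjoint operator in $\mathcal H_\ell$ corresponding to the quadratic form $$v_\ell[\sigma](u)=\int_{-\pi}^{\pi}\sigma(\varphi)\,|u(\pi/2,\varphi)|^2\,d\varphi,\qquad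 u\in\mathcal H_\ell .$$ Theorem 2.1. For every compactly supported function $f\in C^\infty(\mathbb R)$ (real-valued) with $f(0)=0$, $$\lim_{\ell\to\infty}\frac1{\ell+1}\operatorname{Tr} f(V_\ell[\sigma])=\frac1{4\pi}\int_{-\pi}^{\pi}\int_{-1}^{1} f\!\left(\frac{4\sigma_{\rm even}(\varphi)}{\pi\sqrt{1-\xi^2}}\right)d\xi\,d\varphi .$$ Furthermore, the same relation holds with $f(x)=x$. -/

import Mathlib

open MeasureTheory Filter Topology Set
open scoped Real ContDiff InnerProductSpace ComplexConjugate Polynomial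

noncomputable section

namespace Hemisphere

/-- Associated Legendre function `P_ℓ^k`, `k ≥ 0`, by the Rodrigues formula
`P_ℓ^k(x) = (-1)^k / (2^ℓ ℓ!) * (1 - x²)^(k/2) * (d/dx)^(ℓ+k) (x² - 1)^ℓ`
(with the Condon-Shortley sign). -/
def assocLegendreNat (ℓ k : ℕ) (x : ℝ) : ℝ :=
  (-1) ^ k / (2 ^ ℓ * (ℓ.factorial : ℝ)) * √(1 - x ^ 2) ^ k *
    (Polynomial.derivative^[ℓ + k] ((Polynomial.X ^ 2 - 1) ^ ℓ : ℝ[X])).eval x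

/-- Associated Legendre function `P_ℓ^m` for integers `|m| ≤ ℓ`; for `m = -k < 0` the standard
convention is `P_ℓ^(-k) = (-1)^k (ℓ-k)!/(ℓ+k)! P_ℓ^k`. -/
def assocLegendre (ℓ : ℕ) (m : ℤ) (x : ℝ) : ℝ :=
  if 0 ≤ m then assocLegendreNat ℓ m.natAbs x
  else (-1) ^ m.natAbs * ((ℓ - m.natAbs).factorial : ℝ) / ((ℓ + m.natAbs).factorial : ℝ) *
    assocLegendreNat ℓ m.natAbs x

/-- The spherical harmonic `Y_ℓ^m(θ, φ)` for `|m| ≤ ℓ`, with the normalisation constant for the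
half-sphere. -/
def sphHarm (ℓ : ℕ) (m : ℤ) (θ φ : ℝ) : ℂ :=
  (√((2 * ℓ + 1) / (2 * π) * (((ℓ - m).toNat.factorial : ℝ) / ((ℓ + m).toNat.factorial : ℝ))) : ℝ) *
    (assocLegendre ℓ m (Real.cos θ) : ℝ) * Complex.exp (Complex.I * m * φ)

lemma continuous_assocLegendre (ℓ : ℕ) (m : ℤ) : Continuous (assocLegendre ℓ m) := by
  have h : ∀ k, Continuous (assocLegendreNat ℓ k) := by
    intro k
    unfold assocLegendreNat
    fun_prop
  unfold assocLegendre
  split_ifs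
  · exact h _
  · exact continuous_const.mul (h _)

/-- Polar angles `θ ∈ [0, π/2]`. -/
abbrev Polar : Type := Icc (0 : ℝ) (π / 2)

/-- Azimuthal angles; the two endpoints, which describe the same meridian, form a null set. -/
abbrev Azimuth : Type := Icc (-π) π

/-- The closed upper hemisphere `Ω` in spherical coordinates `(θ, φ)`. -/
abbrev Hemi : Type := Polar × Azimuth

/-- Lebesgue measure `dφ` on the azimuthal angles. -/
def azimuthMeasure : Measure Azimuth := Measure.comap Subtype.val volume

/-- The measure `sin θ dθ` on `[0, π/2]`. -/
def polarMeasure : Measure Polar :=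
  (Measure.comap Subtype.val volume).withDensity (fun θ => ENNReal.ofReal (Real.sin (θ : ℝ)))

/-- The surface measure `sin θ dθ dφ` on the hemisphere. -/
def hemiMeasure : Measure Hemi := polarMeasure.prod azimuthMeasure

lemma half_pi_mem : π / 2 ∈ Icc (0 : ℝ) (π / 2) := ⟨by positivity, le_rfl⟩

lemma isFiniteMeasure_Icc (a b : ℝ) :
    IsFiniteMeasure (Measure.comap Subtype.val volume : Measure (Icc a b)) :=
  ⟨by
    rw [comap_subtype_coe_apply measurableSet_Icc, image_univ, Subtype.range_coe]
    exact measure_Icc_lt_top⟩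

instance : IsFiniteMeasure azimuthMeasure := isFiniteMeasure_Icc _ _

instance : IsFiniteMeasure polarMeasure := by
  have := isFiniteMeasure_Icc 0 (π / 2)
  refine isFiniteMeasure_withDensity_ofReal (f := fun θ : Polar => Real.sin (θ : ℝ)) ?_
  refine (Integrable.of_bound (C := 1) ?_ ?_).2
  · exact (Real.continuous_sin.comp continuous_subtype_val).aestronglyMeasurable
  · exact Eventually.of_forall fun θ => by simpa using Real.abs_sin_le_one θ

instance : IsFiniteMeasure hemiMeasure := by unfold hemiMeasure; infer_instance

/-- Lebesgue measure on a nondegenerate compact interval charges nonempty open sets. -/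
lemma isOpenPosMeasure_Icc {a b : ℝ} (hab : a < b) :
    (Measure.comap Subtype.val volume : Measure (Icc a b)).IsOpenPosMeasure := by
  refine ⟨fun U hU hne h0 => ?_⟩
  obtain ⟨V, hV, rfl⟩ := isOpen_induced_iff.1 hU
  rw [comap_subtype_coe_apply measurableSet_Icc, Subtype.image_preimage_coe] at h0
  obtain ⟨x, hx⟩ := hne
  have hcl : (x : ℝ) ∈ closure (Ioo a b) := by rw [closure_Ioo hab.ne]; exact x.2
  obtain ⟨y, hyV, hy⟩ := mem_closure_iff.1 hcl V hV hx
  have hopen : IsOpen (V ∩ Ioo a b) := hV.inter isOpen_Ioo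
  have hsub : V ∩ Ioo a b ⊆ Icc a b ∩ V := fun z hz => ⟨Ioo_subset_Icc_self hz.2, hz.1⟩
  exact (hopen.measure_pos volume ⟨y, hyV, hy⟩).ne' (measure_mono_null hsub h0)

instance : azimuthMeasure.IsOpenPosMeasure :=
  isOpenPosMeasure_Icc (by linarith [Real.pi_pos])

instance : polarMeasure.IsOpenPosMeasure := by
  have hp := isOpenPosMeasure_Icc (show (0 : ℝ) < π / 2 by positivity)
  refine Measure.AbsolutelyContinuous.isOpenPosMeasure (μ := Measure.comap Subtype.val volume) ?_
  refine withDensity_absolutelyContinuous' ?_ ?_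
  · exact (by fun_prop : Measurable fun θ : Polar => ENNReal.ofReal (Real.sin (θ : ℝ))).aemeasurable
  · have h0 : ∀ᵐ θ : Polar ∂(Measure.comap Subtype.val volume), 
        θ ≠ (⟨0, ⟨le_rfl, by positivity⟩⟩ : Icc (0 : ℝ) (π / 2)) := by
      rw [ae_iff]
      simp only [ne_eq, not_not, ofPred_eq_eq_singleton]
      rw [comap_subtype_coe_apply measurableSet_Icc]
      simp
    filter_upwards [h0] with θ hθ
    have h1 : (0 : ℝ) < θ := lt_of_le_of_ne θ.2.1 fun h => hθ (Subtype.ext h.symm)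
    have h2 := Real.sin_pos_of_pos_of_lt_pi h1 (by linarith [θ.2.2, Real.pi_pos])
    simpa using h2

instance : hemiMeasure.IsOpenPosMeasure := by unfold hemiMeasure; infer_instance

/-- The spherical harmonic `Y_ℓ^m` as a continuous function on the closed hemisphere. -/
def sphHarmC (ℓ : ℕ) (m : ℤ) : C(Hemi, ℂ) where
  toFun p := sphHarm ℓ m p.1 p.2
  continuous_toFun := by
    have := continuous_assocLegendre ℓ m
    unfold sphHarm
    fun_prop

/-- The indices `m = -ℓ, -ℓ+2, …, ℓ-2, ℓ`. -/
def neumannIndices (ℓ : ℕ) : Set ℤ := {m | -(ℓ : ℤ) ≤ m ∧ m ≤ ℓ ∧ Even (m - ℓ)}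

/-- The span of the functions `Y_ℓ^m`, `m = -ℓ, -ℓ+2, …, ℓ`, as continuous functions. -/
def neumannFun (ℓ : ℕ) : Submodule ℂ C(Hemi, ℂ) :=
  Submodule.span ℂ (sphHarmC ℓ '' neumannIndices ℓ)

/-- The Hilbert space `L²(Ω)`. -/
def L2Hemi : Type := Lp ℂ 2 hemiMeasure

instance : NormedAddCommGroup L2Hemi := inferInstanceAs (NormedAddCommGroup (Lp ℂ 2 hemiMeasure))

instance : InnerProductSpace ℂ L2Hemi :=
  inferInstanceAs (InnerProductSpace ℂ (Lp ℂ 2 hemiMeasure))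

instance : CompleteSpace L2Hemi := inferInstanceAs (CompleteSpace (Lp ℂ 2 hemiMeasure))

/-- The embedding of continuous functions on the closed hemisphere into `L²(Ω)`. -/
def toL2 : C(Hemi, ℂ) →ₗ[ℂ] L2Hemi :=
  (ContinuousMap.toLp (E := ℂ) 2 hemiMeasure ℂ : C(Hemi, ℂ) →ₗ[ℂ] Lp ℂ 2 hemiMeasure)

lemma toL2_injective : Function.Injective toL2 :=
  ContinuousMap.toLp_injective hemiMeasure

/-- The inner product of `L²(Ω)` on continuous functions (conjugate-linear in the first entry). -/
lemma inner_toL2 (f g : C(Hemi, ℂ)) :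
    ⟪toL2 f, toL2 g⟫_ℂ = ∫ p, g p * conj (f p) ∂hemiMeasure :=
  ContinuousMap.inner_toLp hemiMeasure f g

/-- `Ran P_ℓ`, the eigenspace of the Neumann Laplacian for the eigenvalue `ℓ(ℓ+1)`: the subspace
of `L²(Ω)` spanned by `Y_ℓ^m`, `m = -ℓ, -ℓ+2, …, ℓ`, with the inner product of `L²(Ω)`. -/
abbrev ranP (ℓ : ℕ) : Submodule ℂ L2Hemi := (neumannFun ℓ).map toL2

instance (ℓ : ℕ) : FiniteDimensional ℂ (neumannFun ℓ) :=
  FiniteDimensional.span_of_finite ℂ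
    (((finite_Icc (-(ℓ : ℤ)) ℓ).subset fun _ hm => ⟨hm.1, hm.2.1⟩).image _)

instance (ℓ : ℕ) : FiniteDimensional ℂ (ranP ℓ) := inferInstance

instance (ℓ : ℕ) : CompleteSpace (ranP ℓ) := FiniteDimensional.complete ℂ _

/-- The continuous representative of an element of `Ran P_ℓ`. -/
def contRep (ℓ : ℕ) : ranP ℓ ≃ₗ[ℂ] neumannFun ℓ :=
  (Submodule.equivMapOfInjective toL2 toL2_injective (neumannFun ℓ)).symm

/-- The restriction `φ ↦ u(π/2, φ)` of `u ∈ Ran P_ℓ` to the equator. -/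
def equator {ℓ : ℕ} (u : ranP ℓ) (φ : Azimuth) : ℂ :=
  (contRep ℓ u : C(Hemi, ℂ)) (⟨π / 2, half_pi_mem⟩, φ)

lemma continuous_equator {ℓ : ℕ} (u : ranP ℓ) : Continuous (equator u) := by
  unfold equator; fun_prop

lemma equator_add {ℓ : ℕ} (u w : ranP ℓ) (φ : Azimuth) :
    equator (u + w) φ = equator u φ + equator w φ := by simp [equator]

lemma equator_smul {ℓ : ℕ} (c : ℂ) (u : ranP ℓ) (φ : Azimuth) :
    equator (c • u) φ = c * equator u φ := by simp [equator]

lemma integrable_form {ℓ : ℕ} {σ : ℝ → ℝ} (hσ : Continuous σ) (u w : ranP ℓ) :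
    Integrable (fun φ : Azimuth => (σ φ : ℂ) * (conj (equator u φ) * equator w φ))
      azimuthMeasure := by
  have h1 := continuous_equator u
  have h2 := continuous_equator w
  have h : Continuous fun φ : Azimuth => (σ φ : ℂ) * (conj (equator u φ) * equator w φ) := by
    fun_prop
  exact h.integrable_of_hasCompactSupport (HasCompactSupport.of_compactSpace _)

/-- The functional `w ↦ ∫ σ(φ) conj(u(π/2,φ)) w(π/2,φ) dφ` on `Ran P_ℓ`: the sesquilinear form
whose diagonal is the quadratic form `v_ℓ[σ](u) = ∫ σ(φ) |u(π/2,φ)|² dφ`. -/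
def form {ℓ : ℕ} {σ : ℝ → ℝ} (hσ : Continuous σ) (u : ranP ℓ) : ranP ℓ →ₗ[ℂ] ℂ where
  toFun w := ∫ φ : Azimuth, (σ φ : ℂ) * (conj (equator u φ) * equator w φ) ∂azimuthMeasure
  map_add' w₁ w₂ := by
    rw [← integral_add (integrable_form hσ u w₁) (integrable_form hσ u w₂)]
    congr 1; ext φ; rw [equator_add]; ring
  map_smul' c w := by
    rw [RingHom.id_apply, smul_eq_mul, ← integral_const_mul]
    congr 1; ext φ; rw [equator_smul]; ring

/-- The operator `V_ℓ[σ]` in `Ran P_ℓ` corresponding to the quadratic form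
`∫ σ(φ) |u(π/2,φ)|² dφ`: the operator with `⟪V u, w⟫ = form u w` (Riesz representation). -/
def V (ℓ : ℕ) {σ : ℝ → ℝ} (hσ : Continuous σ) : ranP ℓ →L[ℂ] ranP ℓ :=
  LinearMap.toContinuousLinearMap
    { toFun := fun u =>
        (InnerProductSpace.toDual ℂ (ranP ℓ)).symm (LinearMap.toContinuousLinearMap (form hσ u))
      map_add' := fun u₁ u₂ => by
        rw [← map_add, ← map_add]
        congr 2
        ext w
        simp only [form, LinearMap.coe_mk, AddHom.coe_mk, LinearMap.add_apply]
        rw [← integral_add (integrable_form hσ u₁ w) (integrable_form hσ u₂ w)]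
        congr 1; ext φ; rw [equator_add, map_add]; ring
      map_smul' := fun c u => by
        rw [RingHom.id_apply]
        conv_rhs => rw [← Complex.conj_conj c]
        rw [← LinearIsometryEquiv.map_smulₛₗ, ← map_smul]
        congr 2
        ext w
        simp only [form, LinearMap.coe_mk, AddHom.coe_mk, LinearMap.smul_apply, smul_eq_mul]
        rw [← integral_const_mul]
        congr 1; ext φ; rw [equator_smul, map_mul]; ring }

/-- The defining property of `V_ℓ[σ]`. -/
lemma inner_V {ℓ : ℕ} {σ : ℝ → ℝ} (hσ : Continuous σ) (u w : ranP ℓ) :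
    ⟪V ℓ hσ u, w⟫_ℂ = ∫ φ : Azimuth, (σ φ : ℂ) * (conj (equator u φ) * equator w φ)
      ∂azimuthMeasure := by
  simp [V, form]

/-- `V_ℓ[σ]` is self-adjoint, so that functions of it are given by the functional calculus. -/
lemma isSelfAdjoint_V {ℓ : ℕ} {σ : ℝ → ℝ} (hσ : Continuous σ) : IsSelfAdjoint (V ℓ hσ) := by
  rw [ContinuousLinearMap.isSelfAdjoint_iff_isSymmetric]
  intro u w
  simp only [ContinuousLinearMap.coe_coe]
  rw [inner_V, ← inner_conj_symm, inner_V, ← integral_conj]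
  congr 1; ext φ
  simp only [map_mul, Complex.conj_conj, Complex.conj_ofReal]; ring

/-- `Tr f(T)` for a self-adjoint operator `T` in a finite-dimensional complex Hilbert space, where
`f(T)` is given by the continuous functional calculus. -/
def trFun {H : Type*} [NormedAddCommGroup H] [InnerProductSpace ℂ H] [CompleteSpace H]
    (f : ℝ → ℝ) (T : H →L[ℂ] H) : ℂ :=
  LinearMap.trace ℂ H ((cfc f T : H →L[ℂ] H) : H →ₗ[ℂ] H)

/-- `σ_even(φ) = (σ(φ) + σ(φ + π)) / 2`. -/
def evenPart (σ : ℝ → ℝ) (φ : ℝ) : ℝ := (σ φ + σ (φ + π)) / 2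

/-- `(1/4π) ∫_{-π}^{π} ∫_{-1}^{1} f(4 σ_even(φ) / (π √(1 - ξ²))) dξ dφ`. -/
def limitValue (f : ℝ → ℝ) (σ : ℝ → ℝ) : ℝ :=
  1 / (4 * π) * ∫ φ in (-π)..π, ∫ ξ in (-1 : ℝ)..1,
    f (4 * evenPart σ φ / (π * √(1 - ξ ^ 2)))

end Hemisphere

end

/-! The space `ranP ℓ` has the orthonormal basis `± Y_ℓ^{2j-ℓ}`, `0 ≤ j ≤ ℓ`, whose restrictions to
the equator are `(w_j / √(2π)) e^{i(2j-ℓ)φ}`. With `n = ℓ + 1`, the operator `V_ℓ[σ]` therefore has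
the `n × n` matrix `w_i w_j s_{i-j}`, where `s_d = (1/2π) ∫ σ e^{-2idφ} dφ`
(`inner_V_neumannBasis`). Only even frequencies occur, so `σ` may be replaced by its even part. The
weights satisfy `w_j² = (2n-1) c_j c_{n-1-j}` with `c_a = (2a choose a) / 4^a` (`radial_zero_sq`).
Since `c_a ~ 1/√(πa)` by Wallis' product, `w_{⌊nt⌋}²` tends to the profile `2/(π√(t(1-t)))`. The
matrix is thus a Toeplitz matrix with slowly varying symbol `profile t * σ_even(φ)`, and a Szegő
theorem predicts the limit `(1/2π) ∫∫ f(profile t * σ_even(φ)) dt dφ`. The substitution `ξ = 2t - 1`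
gives the stated form.

For weights `G(j/n)` with `G` continuous and a trigonometric polynomial `h` in place of `σ_even`,
the matrices are banded, and multiplying them multiplies their symbols up to entries of total size
`o(n)`. This yields the traces of powers, and polynomial approximation yields all continuous `f`
(`tendsto_average_toepMat`).

The profile is unbounded, so replacing `w` by `G` is not a small perturbation in operator norm. It
is small in mean: in any orthonormal basis the diagonals of the two matrices differ by a small
multiple of `n` in total (`sum_abs_toepForm_sub_le`). For convex Lipschitz `f`, Peierls' inequality
turns this into a bound on the difference of traces (`sum_eigenvalues_le`), which gives
`tendsto_average_eigenvalues`. The function `f(x) = x` is itself convex and Lipschitz. A compactly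
supported smooth `f` is the difference of `M√(1+x²) + f` and `M√(1+x²)`, both convex and Lipschitz
for large `M`. -/

namespace Hemisphere

/-! ### Traces of functions of an operator with an eigenbasis; Peierls' inequality -/

section Spectral

variable {E : Type*} [NormedAddCommGroup E] [InnerProductSpace ℂ E] {ι κ : Type*} [Fintype ι]
  [Fintype κ]

lemma inner_apply_of_eigenbasis {T : E →ₗ[ℂ] E} (b : OrthonormalBasis ι ℂ E) {μ : ι → ℝ}
    (h : ∀ i, T (b i) = (μ i : ℂ) • b i) (x : E) :
    (⟪x, T x⟫_ℂ).re = ∑ i, ‖⟪b i, x⟫_ℂ‖ ^ 2 * μ i := by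
  have hT : T x = ∑ i, (⟪b i, x⟫_ℂ * μ i) • b i := by
    conv_lhs => rw [← b.sum_repr' x]
    simp only [map_sum, map_smul, h, smul_smul]
  rw [hT, inner_sum, Complex.re_sum]
  refine Finset.sum_congr rfl fun i _ => ?_
  rw [inner_smul_right, ← inner_conj_symm x (b i), mul_right_comm, Complex.mul_conj,
    Complex.normSq_eq_norm_sq, ← Complex.ofReal_mul, Complex.ofReal_re]

/-- Peierls' inequality: the trace of a convex function dominates the sum of its values at the
diagonal matrix elements in any orthonormal basis. -/
lemma sum_convex_diag_le {T : E →ₗ[ℂ] E} (b : OrthonormalBasis ι ℂ E) {μ : ι → ℝ}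
    (h : ∀ i, T (b i) = (μ i : ℂ) • b i) (c : OrthonormalBasis κ ℂ E) {f : ℝ → ℝ}
    (hf : ConvexOn ℝ univ f) :
    ∑ k, f (⟪c k, T (c k)⟫_ℂ).re ≤ ∑ i, f (μ i) := by
  calc ∑ k, f (⟪c k, T (c k)⟫_ℂ).re
      ≤ ∑ k, ∑ i, ‖⟪b i, c k⟫_ℂ‖ ^ 2 * f (μ i) := by
        refine Finset.sum_le_sum fun k _ => ?_
        rw [inner_apply_of_eigenbasis b h]
        have := hf.map_sum_le (t := Finset.univ) (w := fun i => ‖⟪b i, c k⟫_ℂ‖ ^ 2) (p := μ)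
          (fun i _ => by positivity) (by rw [b.sum_sq_norm_inner_right]; simp) (fun i _ => mem_univ _)
        simpa using this
    _ = ∑ i, f (μ i) := by
        -- The Jensen weights `|⟪b i, c k⟫|²` are doubly stochastic: they also sum to one over `k`.
        rw [Finset.sum_comm]
        refine Finset.sum_congr rfl fun i _ => ?_
        rw [← Finset.sum_mul, c.sum_sq_norm_inner_left]
        simp

/-- Traces of convex Lipschitz functions of two operators are compared through the diagonals of
the operators in orthonormal bases. -/
lemma sum_eigenvalues_le {T S : E →ₗ[ℂ] E} (b : OrthonormalBasis ι ℂ E) {μ : ι → ℝ}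
    (hT : ∀ i, T (b i) = (μ i : ℂ) • b i) (c : OrthonormalBasis κ ℂ E) {ν : κ → ℝ}
    (hS : ∀ i, S (c i) = (ν i : ℂ) • c i) {f : ℝ → ℝ} (hf : ConvexOn ℝ univ f) {L K : ℝ}
    (hL : ∀ x y, |f x - f y| ≤ L * |x - y|) (hL0 : 0 ≤ L)
    (hK : ∑ i, |(⟪b i, T (b i)⟫_ℂ).re - (⟪b i, S (b i)⟫_ℂ).re| ≤ K) :
    ∑ i, f (μ i) ≤ ∑ k, f (ν k) + L * K := by
  have h1 := sum_convex_diag_le c hS b hf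
  -- In the eigenbasis of `T` the diagonal of `T` is exact, so Peierls' inequality is needed only
  -- for `S`.
  have h2 : ∀ i, (⟪b i, T (b i)⟫_ℂ).re = μ i := fun i => by
    rw [hT, inner_smul_right, inner_self_eq_norm_sq_to_K, b.orthonormal.1]
    simp
  have h3 : ∑ i, f (μ i) ≤ ∑ i, (f (⟪b i, S (b i)⟫_ℂ).re +
      L * |(⟪b i, T (b i)⟫_ℂ).re - (⟪b i, S (b i)⟫_ℂ).re|) := by
    refine Finset.sum_le_sum fun i _ => ?_
    rw [h2]
    linarith [le_abs_self (f (μ i) - f (⟪b i, S (b i)⟫_ℂ).re), hL (μ i) (⟪b i, S (b i)⟫_ℂ).re]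
  rw [Finset.sum_add_distrib, ← Finset.mul_sum] at h3
  nlinarith [mul_le_mul_of_nonneg_left hK hL0]

lemma aeval_apply_of_eigenbasis {T : E →L[ℂ] E} (b : OrthonormalBasis ι ℂ E) {μ : ι → ℝ}
    (h : ∀ i, T (b i) = (μ i : ℂ) • b i) (p : ℝ[X]) (i : ι) :
    (Polynomial.aeval T p) (b i) = ((p.eval (μ i) : ℝ) : ℂ) • b i := by
  induction p using Polynomial.induction_on' with
  | add p q hp hq => simp [hp, hq, add_smul]
  | monomial n a =>
    rw [Polynomial.aeval_monomial, Polynomial.eval_monomial]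
    have hpow : ∀ n : ℕ, (T ^ n) (b i) = ((μ i : ℂ) ^ n) • b i := by
      intro n
      induction n with
      | zero => simp
      | succ n ih => rw [pow_succ, mul_apply_eq_comp, h, map_smul, ih, smul_smul,
          pow_succ, mul_comm]
    rw [mul_apply_eq_comp, hpow]
    simp only [Algebra.algebraMap_eq_smul_one, map_smul, Complex.ofReal_mul, Complex.ofReal_pow,
      mul_smul, smul_apply, one_apply_eq_self, Complex.coe_smul]
    rw [smul_comm]

/-- The polynomial `∏ (X - μ_i)` annihilates `T`, so by spectral mapping it vanishes on the
spectrum. -/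
lemma spectrum_subset_of_eigenbasis {T : E →L[ℂ] E} (b : OrthonormalBasis ι ℂ E) {μ : ι → ℝ}
    (h : ∀ i, T (b i) = (μ i : ℂ) • b i) : spectrum ℝ T ⊆ range μ := by
  classical
  intro x hx
  set p : ℝ[X] := ∏ i, (Polynomial.X - Polynomial.C (μ i)) with hp
  have h0 : Polynomial.aeval T p = 0 := by
    apply ContinuousLinearMap.coe_injective
    refine b.toBasis.ext fun i => ?_
    have := aeval_apply_of_eigenbasis b h p i
    rw [show p.eval (μ i) = 0 by
      rw [hp, Polynomial.eval_prod]
      exact Finset.prod_eq_zero (Finset.mem_univ i) (by simp)] at this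
    simpa using this
  have h1 : p.eval x ∈ spectrum ℝ (Polynomial.aeval T p) :=
    spectrum.subset_polynomial_aeval T p ⟨x, hx, rfl⟩
  rw [h0] at h1
  have h2 : p.eval x = 0 := by
    by_contra hne
    refine h1 ?_
    rw [spectrum.mem_resolventSet_iff, sub_zero]
    exact (IsUnit.mk0 _ hne).map (algebraMap ℝ (E →L[ℂ] E))
  rw [hp, Polynomial.eval_prod, Finset.prod_eq_zero_iff] at h2
  obtain ⟨i, -, hi⟩ := h2
  exact ⟨i, by simp at hi; linarith⟩

/-- On the finite spectrum `f` agrees with its Lagrange interpolant at the eigenvalues, so `f(T)` is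
a polynomial in `T`; `f` need not be continuous. -/
lemma trFun_eq_sum [CompleteSpace E] {T : E →L[ℂ] E} (hT : IsSelfAdjoint T)
    (b : OrthonormalBasis ι ℂ E) {μ : ι → ℝ} (h : ∀ i, T (b i) = (μ i : ℂ) • b i) (f : ℝ → ℝ) :
    trFun f T = ((∑ i, f (μ i) : ℝ) : ℂ) := by
  classical
  set p := Lagrange.interpolate (Finset.univ.image μ) id f with hp
  have hpe : ∀ i, p.eval (μ i) = f (μ i) := fun i =>
    Lagrange.eval_interpolate_at_node (s := Finset.univ.image μ) (v := id) f
      (Function.injective_id.injOn) (Finset.mem_image_of_mem _ (Finset.mem_univ i))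
  have hcfc : cfc f T = Polynomial.aeval T p := by
    rw [← cfc_polynomial p T hT]
    refine cfc_congr fun x hx => ?_
    obtain ⟨i, rfl⟩ := spectrum_subset_of_eigenbasis b h hx
    exact (hpe i).symm
  rw [trFun, hcfc, LinearMap.trace_eq_sum_inner _ b, Complex.ofReal_sum]
  refine Finset.sum_congr rfl fun i _ => ?_
  rw [ContinuousLinearMap.coe_coe, aeval_apply_of_eigenbasis b h, hpe, inner_smul_right,
    inner_self_eq_norm_sq_to_K, b.orthonormal.1]
  simp

end Spectral

/-! ### Weighted Toeplitz forms and matrices -/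

section Toeplitz

variable {n : ℕ}

/-- The even trigonometric polynomial `∑ s_j x_j e^{2ijφ}`. -/
noncomputable def trigSum (s : Fin n → ℝ) (x : EuclideanSpace ℂ (Fin n)) (φ : ℝ) : ℂ :=
  ∑ j : Fin n, (s j : ℂ) * x j * Complex.exp (2 * Complex.I * j * φ)

lemma continuous_trigSum (s : Fin n → ℝ) (x : EuclideanSpace ℂ (Fin n)) :
    Continuous (trigSum s x) := by
  unfold trigSum; fun_prop

/-- The quadratic form `(1/2π) ∫ g |∑ s_j x_j e^{2ijφ}|² dφ`. -/
noncomputable def toepForm (s : Fin n → ℝ) (g : ℝ → ℝ) (x : EuclideanSpace ℂ (Fin n)) : ℝ :=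
  1 / (2 * π) * ∫ φ in (-π)..π, g φ * ‖trigSum s x φ‖ ^ 2

lemma norm_exp_two_I (j : ℕ) (φ : ℝ) : ‖Complex.exp (2 * Complex.I * j * φ)‖ = 1 := by
  rw [show (2 * Complex.I * j * φ : ℂ) = ((2 * j * φ : ℝ) : ℂ) * Complex.I by push_cast; ring]
  exact Complex.norm_exp_ofReal_mul_I _

/-- Summing `|∑ s_j x_j e^{2ijφ}|²` over an orthonormal basis gives `∑ s_j²` at every point. -/
lemma sum_norm_trigSum_sq {ι : Type*} [Fintype ι] (s : Fin n → ℝ)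
    (b : OrthonormalBasis ι ℂ (EuclideanSpace ℂ (Fin n))) (φ : ℝ) :
    ∑ i, ‖trigSum s (b i) φ‖ ^ 2 = ∑ j, s j ^ 2 := by
  -- Evaluation at `φ` is the inner product with `v`, so the sum over the basis is `‖v‖²` by
  -- Parseval.
  set v : EuclideanSpace ℂ (Fin n) :=
    WithLp.toLp 2 fun j => conj ((s j : ℂ) * Complex.exp (2 * Complex.I * j * φ)) with hv
  have h1 : ∀ x, trigSum s x φ = ⟪v, x⟫_ℂ := by
    intro x
    rw [PiLp.inner_apply, trigSum]
    refine Finset.sum_congr rfl fun j _ => ?_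
    simp only [hv, RCLike.inner_apply, Complex.conj_conj]
    ring
  simp_rw [h1, b.sum_sq_norm_inner_left]
  rw [EuclideanSpace.norm_sq_eq]
  refine Finset.sum_congr rfl fun j _ => ?_
  simp [hv, norm_exp_two_I, -map_mul]

/-- From `|‖P‖² - ‖Q‖²| ≤ (2‖P‖ + ‖P - Q‖) ‖P - Q‖`, with the cross term split by AM-GM with
parameter `η`. The same inequality is used for the matrices and for their limiting symbols. -/
lemma abs_mul_sq_sub_mul_sq_le {g h ε H η : ℝ} (hgh : |g - h| ≤ ε) (hH : |h| ≤ H) (hη : 0 < η)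
    (P Q : ℂ) : |g * ‖P‖ ^ 2 - h * ‖Q‖ ^ 2| ≤
      ε * ‖P‖ ^ 2 + H * ((1 + 1 / η) * ‖P - Q‖ ^ 2 + η * ‖P‖ ^ 2) := by
  have h1 : |‖P‖ ^ 2 - ‖Q‖ ^ 2| ≤ (1 + 1 / η) * ‖P - Q‖ ^ 2 + η * ‖P‖ ^ 2 := by
    have ha : |‖P‖ - ‖Q‖| ≤ ‖P - Q‖ := abs_norm_sub_norm_le P Q
    have hb : |‖P‖ + ‖Q‖| ≤ 2 * ‖P‖ + ‖P - Q‖ := by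
      rw [abs_of_nonneg (by positivity)]
      linarith [(abs_le.1 ha).1]
    rw [sq_sub_sq, abs_mul]
    calc |‖P‖ + ‖Q‖| * |‖P‖ - ‖Q‖| ≤ (2 * ‖P‖ + ‖P - Q‖) * ‖P - Q‖ := by gcongr
      _ ≤ _ := by
        have : 0 ≤ (1 / √η * ‖P - Q‖ - √η * ‖P‖) ^ 2 := sq_nonneg _
        have h2 : 1 / √η * √η = 1 := by
          field_simp
        have h3 : (1 / √η) ^ 2 = 1 / η := by rw [div_pow, Real.sq_sqrt hη.le]; simp
        have h4 : (√η) ^ 2 = η := Real.sq_sqrt hη.le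
        have h5 : (1 / √η * ‖P - Q‖ - √η * ‖P‖) ^ 2 =
          (1 / √η) ^ 2 * ‖P - Q‖ ^ 2 - 2 * (1 / √η * √η) * ‖P‖ * ‖P - Q‖ + √η ^ 2 * ‖P‖ ^ 2 := by
          ring
        rw [h5, h2, h3, h4] at this
        linarith
  have h0 : 0 ≤ H := (abs_nonneg _).trans hH
  calc |g * ‖P‖ ^ 2 - h * ‖Q‖ ^ 2| = |(g - h) * ‖P‖ ^ 2 + h * (‖P‖ ^ 2 - ‖Q‖ ^ 2)| := by ring_nf
    _ ≤ |g - h| * ‖P‖ ^ 2 + |h| * |‖P‖ ^ 2 - ‖Q‖ ^ 2| := by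
      refine (abs_add_le _ _).trans ?_
      rw [abs_mul, abs_mul, abs_of_nonneg (sq_nonneg ‖P‖)]
    _ ≤ _ := by gcongr

/-- The pointwise inequality is summed over the basis under the integral, where
`sum_norm_trigSum_sq` evaluates every sum exactly. Hence the bound does not depend on the basis, as
for a trace norm. -/
lemma sum_abs_toepForm_sub_le {ι : Type*} [Fintype ι]
    (b : OrthonormalBasis ι ℂ (EuclideanSpace ℂ (Fin n))) (s r : Fin n → ℝ) {g h : ℝ → ℝ}
    (hg : Continuous g) (hh : Continuous h) {ε H η : ℝ} (hgh : ∀ φ, |g φ - h φ| ≤ ε)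
    (hH : ∀ φ, |h φ| ≤ H) (hη : 0 < η) :
    ∑ i, |toepForm s g (b i) - toepForm r h (b i)| ≤
      ε * ∑ j, s j ^ 2 + H * ((1 + 1 / η) * ∑ j, (s j - r j) ^ 2 + η * ∑ j, s j ^ 2) := by
  have hc := fun s i => continuous_trigSum s (b i)
  have h1 : ∀ i, |toepForm s g (b i) - toepForm r h (b i)| ≤ 1 / (2 * π) * ∫ φ in (-π)..π,
      (ε * ‖trigSum s (b i) φ‖ ^ 2 + H * ((1 + 1 / η) * ‖trigSum (s - r) (b i) φ‖ ^ 2 +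
        η * ‖trigSum s (b i) φ‖ ^ 2)) := by
    intro i
    have hs := hc s i
    have hr := hc r i
    have hsr := hc (s - r) i
    rw [toepForm, toepForm, ← mul_sub, abs_mul, abs_of_pos (by positivity),
      ← intervalIntegral.integral_sub (by apply Continuous.intervalIntegrable; fun_prop)
        (by apply Continuous.intervalIntegrable; fun_prop)]
    gcongr
    refine (intervalIntegral.abs_integral_le_integral_abs (by linarith [Real.pi_pos])).trans ?_
    refine intervalIntegral.integral_mono (by linarith [Real.pi_pos])
      (by apply Continuous.intervalIntegrable; fun_prop)
      (by apply Continuous.intervalIntegrable; fun_prop) fun φ => ?_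
    have h2 : trigSum (s - r) (b i) φ = trigSum s (b i) φ - trigSum r (b i) φ := by
      simp only [trigSum, ← Finset.sum_sub_distrib]
      refine Finset.sum_congr rfl fun j _ => ?_
      simp only [Pi.sub_apply, Complex.ofReal_sub]
      ring
    simp only [h2]
    exact abs_mul_sq_sub_mul_sq_le (hgh φ) (hH φ) hη _ _
  refine (Finset.sum_le_sum fun i _ => h1 i).trans (le_of_eq ?_)
  rw [← Finset.mul_sum, ← intervalIntegral.integral_finsetSum fun i _ => by
    have hs := hc s i
    have hsr := hc (s - r) i
    apply Continuous.intervalIntegrable; fun_prop]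
  simp only [Finset.sum_add_distrib, ← Finset.mul_sum, sum_norm_trigSum_sq, Pi.sub_apply]
  rw [intervalIntegral.integral_const, smul_eq_mul]
  field_simp
  ring

/-- The Toeplitz-type matrix of the form `toepForm`. -/
noncomputable def toepMat (s : Fin n → ℝ) (g : ℝ → ℝ) : Matrix (Fin n) (Fin n) ℂ := fun i j =>
  s i * s j * (1 / (2 * π) * ∫ φ in (-π)..π, g φ * Complex.exp (2 * Complex.I * (j - i) * φ))

lemma isHermitian_toepMat (s : Fin n → ℝ) (g : ℝ → ℝ) : (toepMat s g).IsHermitian := by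
  ext i j
  simp only [toepMat, Matrix.conjTranspose_apply, RCLike.star_def, map_mul, Complex.conj_ofReal,
    intervalIntegral, map_sub, ← integral_conj, map_div₀, map_one, map_ofNat, ← Complex.exp_conj,
    Complex.conj_I, map_natCast]
  ring_nf

lemma inner_toepMat (s : Fin n → ℝ) {g : ℝ → ℝ} (hg : Continuous g)
    (x : EuclideanSpace ℂ (Fin n)) :
    (⟪x, (toepMat s g).toEuclideanLin x⟫_ℂ).re = toepForm s g x := by
  have h1 : ∀ φ : ℝ, ((g φ * ‖trigSum s x φ‖ ^ 2 : ℝ) : ℂ) =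
      ∑ i : Fin n, ∑ j : Fin n, (s i * s j * (conj (x i) * x j)) *
        (g φ * Complex.exp (2 * Complex.I * (j - i) * φ)) := by
    intro φ
    have h2 : ((‖trigSum s x φ‖ ^ 2 : ℝ) : ℂ) = conj (trigSum s x φ) * trigSum s x φ := by
      rw [← Complex.normSq_eq_norm_sq, mul_comm, Complex.mul_conj]
    rw [Complex.ofReal_mul, h2]
    rw [trigSum, map_sum, Finset.sum_mul_sum, Finset.mul_sum]
    simp only [Finset.mul_sum]
    refine Finset.sum_congr rfl fun i _ => Finset.sum_congr rfl fun j _ => ?_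
    have h3 : Complex.exp (2 * Complex.I * (j - i) * φ) =
        conj (Complex.exp (2 * Complex.I * i * φ)) * Complex.exp (2 * Complex.I * j * φ) := by
      rw [← Complex.exp_conj, ← Complex.exp_add]
      congr 1
      simp only [map_mul, Complex.conj_ofReal, Complex.conj_I, map_natCast, map_ofNat]
      ring
    rw [h3]
    simp only [map_mul, Complex.conj_ofReal]
    ring
  have h4 : ((toepForm s g x : ℝ) : ℂ) = ⟪x, (toepMat s g).toEuclideanLin x⟫_ℂ := by
    rw [toepForm, Complex.ofReal_mul, ← intervalIntegral.integral_ofReal]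
    simp_rw [h1]
    rw [intervalIntegral.integral_finsetSum fun i _ => by
      apply Continuous.intervalIntegrable; fun_prop]
    rw [PiLp.inner_apply, Finset.mul_sum]
    refine Finset.sum_congr rfl fun i _ => ?_
    rw [intervalIntegral.integral_finsetSum fun j _ => by
      apply Continuous.intervalIntegrable; fun_prop]
    simp only [Matrix.toLpLin_apply, RCLike.inner_apply, Matrix.mulVec, dotProduct,
      Finset.sum_mul, Finset.mul_sum, intervalIntegral.integral_const_mul, toepMat]
    refine Finset.sum_congr rfl fun j _ => ?_
    push_cast
    ring
  rw [← h4, Complex.ofReal_re]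

end Toeplitz

/-! ### Averages over `j < n` as integrals of step functions -/

lemma integral_comp_floor {E : Type*} [NormedAddCommGroup E] [NormedSpace ℝ E] [CompleteSpace E]
    (F : ℕ → E) {n : ℕ} (hn : n ≠ 0) :
    ∫ t in (0 : ℝ)..1, F ⌊n * t⌋₊ = (1 / n : ℝ) • ∑ j ∈ Finset.range n, F j := by
  have hn' : (0 : ℝ) < n := by positivity
  have hcongr : ∀ k : ℕ, ∀ t ∈ Ioo ((k : ℝ) / n) (((k + 1 : ℕ) : ℝ) / n),
      F k = F ⌊n * t⌋₊ := by
    intro k t ht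
    congr 1
    symm
    rw [Nat.floor_eq_iff (by have := ht.1; have : 0 ≤ (k : ℝ) / n := by positivity
                             nlinarith)]
    rw [mem_Ioo, div_lt_iff₀ hn', lt_div_iff₀ hn'] at ht
    push_cast at ht
    constructor <;> nlinarith
  have hle : ∀ k : ℕ, (k : ℝ) / n ≤ ((k + 1 : ℕ) : ℝ) / n := fun k => by gcongr; simp
  have hint : ∀ k < n, IntervalIntegrable (fun t : ℝ => F ⌊n * t⌋₊) volume
      ((k : ℝ) / n) (((k + 1 : ℕ) : ℝ) / n) := by
    intro k _
    refine (intervalIntegrable_const (c := F k)).congr_uIoo ?_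
    rw [uIoo_of_le (hle k)]
    exact hcongr k
  have hsum := intervalIntegral.sum_integral_adjacent_intervals (a := fun k : ℕ => (k : ℝ) / n) hint
  simp only [Nat.cast_zero, zero_div] at hsum
  rw [div_self hn'.ne'] at hsum
  rw [← hsum, Finset.smul_sum]
  refine Finset.sum_congr rfl fun k _ => ?_
  rw [← intervalIntegral.integral_congr_uIoo (f := fun _ => F k) (g := fun t : ℝ => F ⌊n * t⌋₊)
    (by rw [uIoo_of_le (hle k)]; exact hcongr k), intervalIntegral.integral_const]
  congr 1
  push_cast
  ring

/-- Averages `n⁻¹ ∑ F_n(j)` converge to an integral by dominated convergence of the step functions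
`t ↦ F_n(⌊nt⌋)`. -/
lemma tendsto_average {E : Type*} [NormedAddCommGroup E] [NormedSpace ℝ E] [CompleteSpace E] [MeasurableSpace E]
    [BorelSpace E] [SecondCountableTopology E] (F : ℕ → ℕ → E) (G : ℝ → E) (bound : ℝ → ℝ)
    (hb : IntervalIntegrable bound volume 0 1)
    (hF : ∀ n, ∀ t ∈ Ioo (0 : ℝ) 1, ‖F n ⌊n * t⌋₊‖ ≤ bound t)
    (hG : ∀ t ∈ Ioo (0 : ℝ) 1, Tendsto (fun n : ℕ => F n ⌊n * t⌋₊) atTop (𝓝 (G t))) :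
    Tendsto (fun n : ℕ => (1 / n : ℝ) • ∑ j ∈ Finset.range n, F n j) atTop
      (𝓝 (∫ t in (0 : ℝ)..1, G t)) := by
  -- At `t = 1` the index `⌊nt⌋ = n` leaves the range of summation; this point is a null set.
  have hae : ∀ᵐ t : ℝ, t ≠ 1 := by simp [ae_iff]
  have h1 : Tendsto (fun n : ℕ => ∫ t in (0 : ℝ)..1, F n ⌊n * t⌋₊) atTop
      (𝓝 (∫ t in (0 : ℝ)..1, G t)) := by
    refine intervalIntegral.tendsto_integral_filter_of_dominated_convergence bound ?_ ?_ hb ?_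
    · refine Eventually.of_forall fun n => ?_
      have : Measurable fun t : ℝ => F n ⌊n * t⌋₊ :=
        measurable_from_nat.comp (Nat.measurable_floor.comp (measurable_const.mul measurable_id))
      exact this.aestronglyMeasurable
    · refine Eventually.of_forall fun n => ?_
      filter_upwards [hae] with t ht htm
      rw [uIoc_of_le zero_le_one] at htm
      exact hF n t ⟨htm.1, lt_of_le_of_ne htm.2 ht⟩
    · filter_upwards [hae] with t ht htm
      rw [uIoc_of_le zero_le_one] at htm
      exact hG t ⟨htm.1, lt_of_le_of_ne htm.2 ht⟩
  refine h1.congr' ?_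
  filter_upwards [eventually_ne_atTop 0] with n hn
  exact integral_comp_floor (F n) hn

lemma tendsto_floor_mul_div {t : ℝ} (ht : 0 ≤ t) :
    Tendsto (fun n : ℕ => (⌊n * t⌋₊ : ℝ) / n) atTop (𝓝 t) := by
  have := (tendsto_nat_floor_mul_div_atTop (R := ℝ) ht).comp tendsto_natCast_atTop_atTop
  refine this.congr fun n => ?_
  simp [mul_comm]

lemma floor_mul_div_mem {t : ℝ} (ht : t ∈ Ioo (0 : ℝ) 1) (n : ℕ) :
    (⌊n * t⌋₊ : ℝ) / n ∈ Icc (0 : ℝ) 1 := by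
  refine ⟨by positivity, div_le_one_of_le₀ ?_ (by positivity)⟩
  refine (Nat.floor_le (by have := ht.1; positivity)).trans ?_
  nlinarith [ht.2, (Nat.cast_nonneg n : (0 : ℝ) ≤ n)]

lemma tendsto_average_continuous (f : C(ℝ, ℂ)) :
    Tendsto (fun n : ℕ => (1 / n : ℝ) • ∑ j ∈ Finset.range n, f (j / n)) atTop
      (𝓝 (∫ t in (0 : ℝ)..1, f t)) := by
  obtain ⟨C, hC⟩ := isCompact_Icc.exists_bound_of_continuousOn (s := Icc (0 : ℝ) 1)
    f.continuous.continuousOn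
  refine tendsto_average (fun n j => f (j / n)) f (fun _ => C) intervalIntegrable_const ?_ ?_
  · exact fun n t ht => hC _ (floor_mul_div_mem ht n)
  · exact fun t ht => (f.continuous.tendsto t).comp (tendsto_floor_mul_div ht.1.le)

/-! ### Matrix sequences modulo entries of total size `o(n)` -/

/-- A sequence of matrices whose entries have total absolute sum `o(n)`. -/
def Negligible (A : ∀ n : ℕ, Matrix (Fin n) (Fin n) ℂ) : Prop :=
  Tendsto (fun n => (∑ i, ∑ j, ‖A n i j‖) / n) atTop (𝓝 0)

/-- A sequence of matrices with uniformly bounded absolute row and column sums. -/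
def SumBounded (A : ∀ n : ℕ, Matrix (Fin n) (Fin n) ℂ) : Prop :=
  ∃ C : ℝ, ∀ n, (∀ i, ∑ j, ‖A n i j‖ ≤ C) ∧ ∀ j, ∑ i, ‖A n i j‖ ≤ C

section Classes

variable {A B : ∀ n : ℕ, Matrix (Fin n) (Fin n) ℂ}

lemma Negligible.of_le {u : ℕ → ℝ} (hu : Tendsto (fun n => u n / n) atTop (𝓝 0))
    (h : ∀ n, ∑ i, ∑ j, ‖A n i j‖ ≤ u n) : Negligible A :=
  squeeze_zero (fun n => by positivity) (fun n => by gcongr; exact h n) hu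

lemma Negligible.add (hA : Negligible A) (hB : Negligible B) :
    Negligible fun n => A n + B n := by
  have := Tendsto.add hA hB
  refine Negligible.of_le (u := fun n => (∑ i, ∑ j, ‖A n i j‖) + ∑ i, ∑ j, ‖B n i j‖) ?_ fun n => ?_
  · simpa [add_div] using this
  · rw [← Finset.sum_add_distrib]
    refine Finset.sum_le_sum fun i _ => ?_
    rw [← Finset.sum_add_distrib]
    exact Finset.sum_le_sum fun j _ => norm_add_le _ _

lemma norm_mul_apply_le {n : ℕ} (A B : Matrix (Fin n) (Fin n) ℂ) (i j : Fin n) :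
    ‖(A * B) i j‖ ≤ ∑ k, ‖A i k‖ * ‖B k j‖ := by
  rw [Matrix.mul_apply]
  exact (norm_sum_le _ _).trans (Finset.sum_le_sum fun k _ => (norm_mul_le _ _))

/-- Summing `|A_ik| |B_kj|` over `j` first leaves a row sum of `B`. Together with the mirror
statement `Negligible.bounded_mul`, which uses column sums, negligible sequences behave as a
two-sided ideal. -/
lemma Negligible.mul_bounded (hA : Negligible A) (hB : SumBounded B) :
    Negligible fun n => A n * B n := by
  obtain ⟨C, hC⟩ := hB
  refine Negligible.of_le (u := fun n => (∑ i, ∑ j, ‖A n i j‖) * C) ?_ fun n => ?_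
  · simpa [mul_div_right_comm] using Tendsto.mul_const C hA
  · rw [Finset.sum_mul]
    refine Finset.sum_le_sum fun i _ => ?_
    calc ∑ j, ‖(A n * B n) i j‖ ≤ ∑ j, ∑ k, ‖A n i k‖ * ‖B n k j‖ :=
          Finset.sum_le_sum fun j _ => norm_mul_apply_le _ _ i j
      _ = ∑ k, ‖A n i k‖ * ∑ j, ‖B n k j‖ := by
          rw [Finset.sum_comm]; simp_rw [Finset.mul_sum]
      _ ≤ ∑ k, ‖A n i k‖ * C := by
          gcongr with k; exact (hC n).1 k
      _ = _ := by rw [Finset.sum_mul]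

lemma Negligible.bounded_mul (hB : Negligible B) (hA : SumBounded A) :
    Negligible fun n => A n * B n := by
  obtain ⟨C, hC⟩ := hA
  refine Negligible.of_le (u := fun n => C * (∑ i, ∑ j, ‖B n i j‖)) ?_ fun n => ?_
  · simpa [mul_div_assoc] using Tendsto.const_mul C hB
  · calc ∑ i, ∑ j, ‖(A n * B n) i j‖ ≤ ∑ i, ∑ j, ∑ k, ‖A n i k‖ * ‖B n k j‖ :=
          Finset.sum_le_sum fun i _ => Finset.sum_le_sum fun j _ => norm_mul_apply_le _ _ i j
      _ = ∑ k, ∑ j, (∑ i, ‖A n i k‖) * ‖B n k j‖ := by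
          simp_rw [Finset.sum_mul]
          rw [Finset.sum_comm_cycle]
          refine Finset.sum_congr rfl fun k _ => ?_
          rw [Finset.sum_comm]
      _ ≤ ∑ k, ∑ j, C * ‖B n k j‖ := by
          gcongr with k _ j; exact (hC n).2 k
      _ = _ := by simp_rw [Finset.mul_sum]

lemma SumBounded.mul (hA : SumBounded A) (hB : SumBounded B) :
    SumBounded fun n => A n * B n := by
  obtain ⟨C, hC⟩ := hA
  obtain ⟨D, hD⟩ := hB
  refine ⟨max C 0 * max D 0, fun n => ⟨fun i => ?_, fun j => ?_⟩⟩
  · calc ∑ j, ‖(A n * B n) i j‖ ≤ ∑ j, ∑ k, ‖A n i k‖ * ‖B n k j‖ :=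
          Finset.sum_le_sum fun j _ => norm_mul_apply_le _ _ i j
      _ = ∑ k, ‖A n i k‖ * ∑ j, ‖B n k j‖ := by
          rw [Finset.sum_comm]; simp_rw [Finset.mul_sum]
      _ ≤ ∑ k, ‖A n i k‖ * max D 0 := by
          gcongr with k; exact ((hD n).1 k).trans (le_max_left _ _)
      _ = (∑ k, ‖A n i k‖) * max D 0 := by rw [Finset.sum_mul]
      _ ≤ _ := by gcongr; exact ((hC n).1 i).trans (le_max_left _ _)
  · calc ∑ i, ‖(A n * B n) i j‖ ≤ ∑ i, ∑ k, ‖A n i k‖ * ‖B n k j‖ :=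
          Finset.sum_le_sum fun i _ => norm_mul_apply_le _ _ i j
      _ = ∑ k, (∑ i, ‖A n i k‖) * ‖B n k j‖ := by
          rw [Finset.sum_comm]; simp_rw [Finset.sum_mul]
      _ ≤ ∑ k, max C 0 * ‖B n k j‖ := by
          gcongr with k; exact ((hC n).2 k).trans (le_max_left _ _)
      _ = max C 0 * (∑ k, ‖B n k j‖) := by rw [Finset.mul_sum]
      _ ≤ _ := by gcongr; exact ((hD n).2 j).trans (le_max_left _ _)

lemma SumBounded.add (hA : SumBounded A) (hB : SumBounded B) :
    SumBounded fun n => A n + B n := by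
  obtain ⟨C, hC⟩ := hA
  obtain ⟨D, hD⟩ := hB
  refine ⟨C + D, fun n => ⟨fun i => ?_, fun j => ?_⟩⟩
  · refine (Finset.sum_le_sum fun j _ => norm_add_le (A n i j) (B n i j)).trans ?_
    rw [Finset.sum_add_distrib]
    exact add_le_add ((hC n).1 i) ((hD n).1 i)
  · refine (Finset.sum_le_sum fun i _ => norm_add_le (A n i j) (B n i j)).trans ?_
    rw [Finset.sum_add_distrib]
    exact add_le_add ((hC n).2 j) ((hD n).2 j)

lemma SumBounded.one : SumBounded fun _ => 1 := by
  refine ⟨1, fun n => ⟨fun i => ?_, fun j => ?_⟩⟩ <;> simp [Matrix.one_apply, apply_ite norm]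

lemma SumBounded.pow (hA : SumBounded A) (k : ℕ) : SumBounded fun n => A n ^ k := by
  induction k with
  | zero => simpa using SumBounded.one
  | succ k ih => simpa [pow_succ] using ih.mul hA

lemma Negligible.tendsto_trace (hA : Negligible A) :
    Tendsto (fun n : ℕ => (A n).trace / n) atTop (𝓝 0) := by
  refine squeeze_zero_norm (fun n => ?_) hA
  rw [norm_div, Complex.norm_natCast]
  gcongr
  refine (norm_sum_le _ _).trans (Finset.sum_le_sum fun i _ => ?_)
  exact Finset.single_le_sum (f := fun j => ‖A n i j‖) (fun j _ => norm_nonneg _)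
    (Finset.mem_univ i)

end Classes

/-! ### Symbol calculus for banded variable-coefficient Toeplitz matrices -/

/-- The variable-coefficient Toeplitz matrix with entries `a_{i-j}(i/n)`. -/
noncomputable def opMat (a : LaurentPolynomial C(ℝ, ℂ)) (n : ℕ) : Matrix (Fin n) (Fin n) ℂ :=
  fun i j => a.coeff ((i : ℤ) - j) ((i : ℝ) / n)

lemma opMat_add (a b : LaurentPolynomial C(ℝ, ℂ)) (n : ℕ) :
    opMat (a + b) n = opMat a n + opMat b n := by
  ext i j; simp [opMat, AddMonoidAlgebra.coeff_add]

lemma opMat_C_mul_T (d : ℤ) (α : C(ℝ, ℂ)) (n : ℕ) (i j : Fin n) :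
    opMat (LaurentPolynomial.C α * LaurentPolynomial.T d) n i j =
      if (i : ℤ) - j = d then α ((i : ℝ) / n) else 0 := by
  rw [← LaurentPolynomial.single_eq_C_mul_T, opMat, AddMonoidAlgebra.coeff_single,
    Finsupp.single_apply]
  simp only [eq_comm]
  split_ifs <;> rfl

lemma div_mem_Icc {n : ℕ} (i : Fin n) : (i : ℝ) / n ∈ Icc (0 : ℝ) 1 :=
  ⟨by positivity, div_le_one_of_le₀ (by exact_mod_cast i.2.le) (by positivity)⟩

lemma exists_bound_Icc (α : C(ℝ, ℂ)) : ∃ C, 0 ≤ C ∧ ∀ t ∈ Icc (0 : ℝ) 1, ‖α t‖ ≤ C := by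
  obtain ⟨C, hC⟩ := isCompact_Icc.exists_bound_of_continuousOn (s := Icc (0 : ℝ) 1)
    α.continuous.continuousOn
  exact ⟨C, (norm_nonneg _).trans (hC 0 (by simp)), hC⟩

lemma sum_ite_sub_le {n : ℕ} (d : ℤ) {x : ℝ} (hx : 0 ≤ x) (i : Fin n) :
    ∑ j : Fin n, (if (i : ℤ) - j = d then x else 0) ≤ x := by
  rw [← Finset.sum_filter, Finset.sum_const, nsmul_eq_mul]
  have : (Finset.univ.filter fun j : Fin n => (i : ℤ) - j = d).card ≤ 1 := by
    refine Finset.card_le_one.2 fun a ha b hb => ?_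
    simp only [Finset.mem_filter, Finset.mem_univ, true_and] at ha hb
    exact Fin.ext (by omega)
  have : ((Finset.univ.filter fun j : Fin n => (i : ℤ) - j = d).card : ℝ) ≤ 1 := by
    exact_mod_cast this
  nlinarith

lemma sum_ite_sub_le' {n : ℕ} (d : ℤ) {x : ℝ} (hx : 0 ≤ x) (j : Fin n) :
    ∑ i : Fin n, (if (i : ℤ) - j = d then x else 0) ≤ x := by
  refine le_trans (le_of_eq ?_) (sum_ite_sub_le (-d) hx j)
  refine Finset.sum_congr rfl fun i _ => ?_
  congr 1
  exact propext ⟨fun h => by omega, fun h => by omega⟩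

lemma sumBounded_opMat (a : LaurentPolynomial C(ℝ, ℂ)) : SumBounded (opMat a) := by
  induction a using LaurentPolynomial.induction_on' with
  | add p q hp hq =>
    rw [funext (opMat_add p q)]
    exact hp.add hq
  | C_mul_T d α =>
    obtain ⟨C, hC0, hC⟩ := exists_bound_Icc α
    have h : ∀ n, ∀ i j : Fin n, ‖opMat (LaurentPolynomial.C α * LaurentPolynomial.T d) n i j‖ ≤
        if (i : ℤ) - j = d then C else 0 := by
      intro n i j
      rw [opMat_C_mul_T]
      split_ifs
      · exact hC _ (div_mem_Icc i)
      · simp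
    exact ⟨C, fun n => ⟨fun i => (Finset.sum_le_sum fun j _ => h n i j).trans
      (sum_ite_sub_le d hC0 i), fun j => (Finset.sum_le_sum fun i _ => h n i j).trans
      (sum_ite_sub_le' d hC0 j)⟩⟩

/-- The index `i - d` falls outside `[0, n)` only in boundary rows: `i < d` if `d > 0`, and `i ≥ n +
d` if `d < 0`. -/
lemma card_filter_forall_sub_ne_le (n : ℕ) (d : ℤ) :
    (Finset.univ.filter fun i : Fin n => ∀ k : Fin n, (i : ℤ) - k ≠ d).card ≤ d.natAbs := by
  have h : (Finset.univ.filter fun i : Fin n => ∀ k : Fin n, (i : ℤ) - k ≠ d).card ≤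
      (Finset.Ico 0 d ∪ Finset.Ico (n + d) n).card := by
    refine Finset.card_le_card_of_injOn (fun i => (i : ℤ)) (fun i hi => ?_) fun i _ j _ hij => ?_
    · simp only [Finset.coe_filter, Finset.mem_univ, true_and, mem_ofPred_eq] at hi
      simp only [Finset.coe_union, Finset.coe_Ico, mem_union, mem_Ico]
      by_contra hcon
      push Not at hcon
      have h1 : 0 ≤ (i : ℤ) - d := by
        by_contra h; have := hcon.1 (by omega); omega
      have h2 : (i : ℤ) - d < n := by
        by_contra h; have := hcon.2 (by omega); omega
      refine hi ⟨((i : ℤ) - d).toNat, by omega⟩ ?_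
      simp only
      omega
    · exact Fin.ext (by simpa using hij)
  refine h.trans ((Finset.card_union_le _ _).trans ?_)
  rw [Int.card_Ico, Int.card_Ico]
  omega

lemma eventually_norm_sub_le (β : C(ℝ, ℂ)) (d : ℤ) {ε : ℝ} (hε : 0 < ε) :
    ∀ᶠ n : ℕ in atTop, ∀ i k : Fin n, (i : ℤ) - k = d → ‖β (k / n) - β (i / n)‖ ≤ ε := by
  have huc : UniformContinuousOn β (Icc 0 1) :=
    isCompact_Icc.uniformContinuousOn_of_continuous β.continuous.continuousOn
  obtain ⟨δ, hδ, h⟩ := Metric.uniformContinuousOn_iff.1 huc ε hε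
  have hlim : Tendsto (fun n : ℕ => |(d : ℝ)| / n) atTop (𝓝 0) :=
    tendsto_const_div_atTop_nhds_zero_nat _
  filter_upwards [hlim.eventually (gt_mem_nhds hδ)] with n hn i k hik
  rw [← dist_eq_norm]
  refine (h _ (div_mem_Icc k) _ (div_mem_Icc i) ?_).le
  rw [Real.dist_eq, ← sub_div, abs_div, abs_of_nonneg (Nat.cast_nonneg n : (0 : ℝ) ≤ n)]
  rwa [abs_sub_comm, show ((i : ℕ) : ℝ) - (k : ℕ) = d by exact_mod_cast hik]

/-- The product has the entry `α(i/n) β(k/n)` with `k = i - d`, whereas the product symbol gives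
`α(i/n) β(i/n)`. Uniform continuity of `β` controls the shift by `d/n`, and the rows in which no
such `k` exists number at most `|d|`. -/
lemma negligible_opMat_mul_monomials (d e : ℤ) (α β : C(ℝ, ℂ)) :
    Negligible fun n => opMat (LaurentPolynomial.C α * LaurentPolynomial.T d) n *
      opMat (LaurentPolynomial.C β * LaurentPolynomial.T e) n -
      opMat (LaurentPolynomial.C α * LaurentPolynomial.T d *
        (LaurentPolynomial.C β * LaurentPolynomial.T e)) n := by
  obtain ⟨A, hA0, hA⟩ := exists_bound_Icc α
  obtain ⟨B, hB0, hB⟩ := exists_bound_Icc β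
  have hprod : LaurentPolynomial.C α * LaurentPolynomial.T d *
        (LaurentPolynomial.C β * LaurentPolynomial.T e) =
      LaurentPolynomial.C (α * β) * LaurentPolynomial.T (d + e) := by
    rw [map_mul, LaurentPolynomial.T_add]; ring
  rw [hprod]
  set M : ∀ n : ℕ, Matrix (Fin n) (Fin n) ℂ := fun n =>
    opMat (LaurentPolynomial.C α * LaurentPolynomial.T d) n *
      opMat (LaurentPolynomial.C β * LaurentPolynomial.T e) n -
      opMat (LaurentPolynomial.C (α * β) * LaurentPolynomial.T (d + e)) n with hM
  -- `A * ε` pays for the shift in the argument of `β`; `A * B` is paid only in truncated boundary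
  -- rows.
  have hentry : ∀ (n : ℕ) (ε : ℝ), 0 ≤ ε →
      (∀ i k : Fin n, (i : ℤ) - k = d → ‖β (k / n) - β (i / n)‖ ≤ ε) → ∀ i j : Fin n,
      ‖M n i j‖ ≤ if (i : ℤ) - j = d + e then
        A * ε + (if ∀ k : Fin n, (i : ℤ) - k ≠ d then A * B else 0) else 0 := by
    intro n ε hε0 hε i j
    simp only [hM, Matrix.sub_apply, Matrix.mul_apply, opMat_C_mul_T]
    by_cases hk : ∀ k : Fin n, (i : ℤ) - k ≠ d
    · rw [Finset.sum_eq_zero fun k _ => by rw [if_neg (hk k), zero_mul], if_pos hk]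
      split_ifs
      · rw [zero_sub, norm_neg, ContinuousMap.mul_apply, norm_mul]
        have h1 := hA _ (div_mem_Icc i)
        have h2 := hB _ (div_mem_Icc i)
        have h3 := mul_le_mul h1 h2 (norm_nonneg _) hA0
        have h4 : 0 ≤ A * ε := by positivity
        linarith
      · simp
    · rw [if_neg hk]
      push Not at hk
      obtain ⟨k, hk⟩ := hk
      rw [Finset.sum_eq_single_of_mem k (Finset.mem_univ k) fun l _ hl => by
        rw [if_neg (fun h => hl (Fin.ext (by omega))), zero_mul], if_pos hk]
      by_cases hij : (i : ℤ) - j = d + e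
      · rw [if_pos hij, if_pos hij, if_pos (by omega), ContinuousMap.mul_apply, ← mul_sub,
          norm_mul, add_zero]
        exact mul_le_mul (hA _ (div_mem_Icc i)) (hε i k hk) (norm_nonneg _) hA0
      · rw [if_neg hij, if_neg hij, if_neg (by omega)]
        simp
  have hsum : ∀ (n : ℕ) (ε : ℝ), 0 ≤ ε →
      (∀ i k : Fin n, (i : ℤ) - k = d → ‖β (k / n) - β (i / n)‖ ≤ ε) →
      ∑ i, ∑ j, ‖M n i j‖ ≤ n * (A * ε) + d.natAbs * (A * B) := by
    intro n ε hε0 hε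
    calc ∑ i, ∑ j, ‖M n i j‖ ≤ ∑ i : Fin n,
          (A * ε + if ∀ k : Fin n, (i : ℤ) - k ≠ d then A * B else 0) := by
          refine Finset.sum_le_sum fun i _ => ?_
          refine (Finset.sum_le_sum fun j _ => hentry n ε hε0 hε i j).trans ?_
          refine sum_ite_sub_le _ ?_ i
          split_ifs <;> positivity
      _ ≤ _ := by
          rw [Finset.sum_add_distrib, ← Finset.sum_filter, Finset.sum_const, Finset.sum_const,
            Finset.card_univ, Fintype.card_fin, nsmul_eq_mul, nsmul_eq_mul]
          have h1 : ((Finset.univ.filter fun i : Fin n => ∀ k : Fin n, (i : ℤ) - k ≠ d).card : ℝ)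
            ≤ d.natAbs := by exact_mod_cast card_filter_forall_sub_ne_le n d
          gcongr
  rw [Negligible, Metric.tendsto_atTop']
  intro ε hε
  have hε' : 0 < ε / (2 * (A + 1)) := by positivity
  have hlim : Tendsto (fun n : ℕ => (d.natAbs * (A * B) : ℝ) / n) atTop (𝓝 0) :=
    tendsto_const_div_atTop_nhds_zero_nat _
  obtain ⟨N, hN⟩ := eventually_atTop.1 (((eventually_norm_sub_le β d hε').and
    (hlim.eventually (gt_mem_nhds (half_pos hε)))).and (eventually_gt_atTop 0))
  refine ⟨N, fun n hn => ?_⟩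
  obtain ⟨⟨h1, h2⟩, h3⟩ := hN n hn.le
  rw [Real.dist_eq, sub_zero, abs_of_nonneg (by positivity)]
  have h3' : (0 : ℝ) < n := by exact_mod_cast h3
  have h4 : A * (ε / (2 * (A + 1))) ≤ ε / 2 := by
    rw [show ε / 2 = (A + 1) * (ε / (2 * (A + 1))) by field_simp]
    gcongr; linarith
  calc (∑ i, ∑ j, ‖M n i j‖) / n
      ≤ (n * (A * (ε / (2 * (A + 1)))) + d.natAbs * (A * B)) / n := by
        gcongr; exact hsum n _ hε'.le h1
    _ = A * (ε / (2 * (A + 1))) + d.natAbs * (A * B) / n := by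
        field_simp
    _ < ε := by linarith

/-- `opMat` is multiplicative up to negligible matrices. -/
lemma negligible_opMat_mul (a b : LaurentPolynomial C(ℝ, ℂ)) :
    Negligible fun n => opMat a n * opMat b n - opMat (a * b) n := by
  induction a using LaurentPolynomial.induction_on' with
  | add p q hp hq =>
    convert hp.add hq using 2 with n
    rw [add_mul, opMat_add, opMat_add, add_mul]; abel
  | C_mul_T d α =>
    induction b using LaurentPolynomial.induction_on' with
    | add p q hp hq =>
      convert hp.add hq using 2 with n
      rw [mul_add, opMat_add, opMat_add, mul_add]; abel
    | C_mul_T e β => exact negligible_opMat_mul_monomials d e α β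

/-- Telescoping: `A (B - op b) + (A - op a) op b + (op a op b - op (ab))`, where `op` stands for
`opMat`. -/
lemma negligible_mul_sub {A B : ∀ n : ℕ, Matrix (Fin n) (Fin n) ℂ}
    {a b : LaurentPolynomial C(ℝ, ℂ)} (hA : SumBounded A) (hAa : Negligible fun n => A n - opMat a n)
    (hBb : Negligible fun n => B n - opMat b n) :
    Negligible fun n => A n * B n - opMat (a * b) n := by
  convert ((hBb.bounded_mul hA).add (hAa.mul_bounded (sumBounded_opMat b))).add
    (negligible_opMat_mul a b) using 2 with n
  noncomm_ring

lemma opMat_one (n : ℕ) : opMat 1 n = 1 := by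
  ext i j
  have := opMat_C_mul_T 0 1 n i j
  rw [LaurentPolynomial.T_zero, map_one, mul_one] at this
  rw [this, Matrix.one_apply]
  congr 1
  exact propext ⟨fun h => Fin.ext (by omega), fun h => by simp [h]⟩

lemma negligible_zero : Negligible fun _ => 0 := by simp [Negligible]

lemma negligible_pow_sub {A : ∀ n : ℕ, Matrix (Fin n) (Fin n) ℂ}
    {a : LaurentPolynomial C(ℝ, ℂ)} (hA : SumBounded A) (hAa : Negligible fun n => A n - opMat a n)
    (k : ℕ) : Negligible fun n => A n ^ k - opMat (a ^ k) n := by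
  induction k with
  | zero => simpa [opMat_one] using negligible_zero
  | succ k ih => simpa only [pow_succ] using negligible_mul_sub (hA.pow k) ih hAa

/-- The diagonal entries are `a_0(i/n)`, so the normalised trace is a Riemann sum. -/
lemma tendsto_trace_opMat (a : LaurentPolynomial C(ℝ, ℂ)) :
    Tendsto (fun n : ℕ => (opMat a n).trace / n) atTop
      (𝓝 (∫ t in (0 : ℝ)..1, a.coeff 0 t)) := by
  refine (tendsto_average_continuous (a.coeff 0)).congr fun n => ?_
  rw [Matrix.trace, ← Fin.sum_univ_eq_sum_range fun j => a.coeff 0 ((j : ℝ) / n)]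
  simp only [Matrix.diag, opMat, sub_self, Complex.real_smul]
  push_cast
  rw [mul_comm, mul_one_div]

lemma tendsto_trace_pow {A : ∀ n : ℕ, Matrix (Fin n) (Fin n) ℂ}
    {a : LaurentPolynomial C(ℝ, ℂ)} (hA : SumBounded A) (hAa : Negligible fun n => A n - opMat a n)
    (k : ℕ) : Tendsto (fun n : ℕ => (A n ^ k).trace / n) atTop
      (𝓝 (∫ t in (0 : ℝ)..1, (a ^ k).coeff 0 t)) := by
  have := (negligible_pow_sub hA hAa k).tendsto_trace.add (tendsto_trace_opMat (a ^ k))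
  rw [zero_add] at this
  refine this.congr fun n => ?_
  rw [Matrix.trace_sub]; ring

/-! ### Symbols as functions of `(t, φ)` and their Fourier coefficients -/

/-- The value at `(t, φ)` of the symbol `∑ a_d(t) e^{2idφ}`. -/
noncomputable def symbolEval (t φ : ℝ) : LaurentPolynomial C(ℝ, ℂ) →+* ℂ :=
  LaurentPolynomial.eval₂ (ContinuousMap.evalAlgHom ℂ ℂ t).toRingHom
    (Units.mk0 (Complex.exp (2 * Complex.I * φ)) (Complex.exp_ne_zero _))

lemma symbolEval_C_mul_T (t φ : ℝ) (α : C(ℝ, ℂ)) (d : ℤ) :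
    symbolEval t φ (LaurentPolynomial.C α * LaurentPolynomial.T d) =
      α t * Complex.exp (2 * Complex.I * d * φ) := by
  rw [symbolEval, LaurentPolynomial.eval₂_C_mul_T, Units.val_zpow_eq_zpow_val, Units.val_mk0,
    ← Complex.exp_int_mul]
  change α t * _ = _
  ring_nf

attribute [irreducible] symbolEval

lemma continuous_symbolEval (a : LaurentPolynomial C(ℝ, ℂ)) :
    Continuous fun q : ℝ × ℝ => symbolEval q.1 q.2 a := by
  induction a using LaurentPolynomial.induction_on' with
  | add p q hp hq =>
    simp only [map_add]
    exact hp.add hq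
  | C_mul_T d α => simp only [symbolEval_C_mul_T]; fun_prop

lemma integral_exp_two_I (d : ℤ) :
    1 / (2 * π) * ∫ φ in (-π)..π, Complex.exp (2 * Complex.I * d * φ) = if d = 0 then 1 else 0 := by
  have hpi : (π : ℂ) ≠ 0 := by exact_mod_cast Real.pi_ne_zero
  split_ifs with h
  · subst h
    simp
    field_simp
    norm_num
  · have hd : (d : ℂ) ≠ 0 := by exact_mod_cast h
    rw [integral_exp_mul_complex (by simp [hd])]
    have : Complex.exp (2 * Complex.I * d * (π : ℝ)) =
        Complex.exp (2 * Complex.I * d * ((-π : ℝ) : ℂ)) := by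
      rw [Complex.exp_eq_exp_iff_exists_int]
      exact ⟨2 * d, by push_cast; ring⟩
    rw [this]; simp

lemma coeff_C_mul_T (α : C(ℝ, ℂ)) (d e : ℤ) :
    (LaurentPolynomial.C α * LaurentPolynomial.T d).coeff e = if d = e then α else 0 := by
  rw [← LaurentPolynomial.single_eq_C_mul_T, AddMonoidAlgebra.coeff_single, Finsupp.single_apply]

lemma fourierCoeff_symbolEval (a : LaurentPolynomial C(ℝ, ℂ)) (t : ℝ) (e : ℤ) :
    1 / (2 * π) * ∫ φ in (-π)..π, symbolEval t φ a * Complex.exp (2 * Complex.I * (-e : ℤ) * φ) =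
      a.coeff e t := by
  induction a using LaurentPolynomial.induction_on' with
  | add p q hp hq =>
    have hc : ∀ a, Continuous fun φ => symbolEval t φ a := fun a =>
      (continuous_symbolEval a).comp (by fun_prop : Continuous fun φ : ℝ => (t, φ))
    have hi : ∀ a, IntervalIntegrable (fun φ : ℝ => symbolEval t φ a *
        Complex.exp (2 * Complex.I * (-e : ℤ) * φ)) volume (-π) π := fun a =>
      ((hc a).mul (by fun_prop)).intervalIntegrable _ _
    simp only [map_add, add_mul]
    rw [intervalIntegral.integral_add (hi p) (hi q), mul_add, hp, hq,
      AddMonoidAlgebra.coeff_add, Finsupp.add_apply, ContinuousMap.add_apply]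
  | C_mul_T d α =>
    have h : ∀ φ : ℝ, symbolEval t φ (LaurentPolynomial.C α * LaurentPolynomial.T d) *
        Complex.exp (2 * Complex.I * (-e : ℤ) * φ) =
        α t * Complex.exp (2 * Complex.I * (d - e : ℤ) * φ) := by
      intro φ
      rw [symbolEval_C_mul_T, mul_assoc, ← Complex.exp_add]
      push_cast
      ring_nf
    simp_rw [h]
    rw [intervalIntegral.integral_const_mul, mul_left_comm, integral_exp_two_I, coeff_C_mul_T]
    simp only [sub_eq_zero]
    split_ifs <;> simp

lemma continuous_integral_symbolEval (a : LaurentPolynomial C(ℝ, ℂ)) :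
    Continuous fun φ => ∫ t in (0 : ℝ)..1, symbolEval t φ a :=
  intervalIntegral.continuous_parametric_intervalIntegral_of_continuous' (μ := volume)
    (f := fun φ t => symbolEval t φ a) ((continuous_symbolEval a).comp continuous_swap) 0 1

lemma integral_symbolEval (a : LaurentPolynomial C(ℝ, ℂ)) :
    1 / (2 * π) * ∫ φ in (-π)..π, ∫ t in (0 : ℝ)..1, symbolEval t φ a =
      ∫ t in (0 : ℝ)..1, a.coeff 0 t := by
  induction a using LaurentPolynomial.induction_on' with
  | add p q hp hq =>
    have hc : ∀ a φ, Continuous fun t => symbolEval t φ a := fun a φ =>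
      (continuous_symbolEval a).comp (by fun_prop : Continuous fun t : ℝ => (t, φ))
    simp only [map_add]
    simp_rw [intervalIntegral.integral_add ((hc p _).intervalIntegrable _ _)
      ((hc q _).intervalIntegrable _ _)]
    rw [intervalIntegral.integral_add ((continuous_integral_symbolEval p).intervalIntegrable _ _)
      ((continuous_integral_symbolEval q).intervalIntegrable _ _), mul_add, hp, hq,
      AddMonoidAlgebra.coeff_add, Finsupp.add_apply,
      ← intervalIntegral.integral_add ((p.coeff 0).continuous.intervalIntegrable _ _)
      ((q.coeff 0).continuous.intervalIntegrable _ _)]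
    simp only [ContinuousMap.add_apply]
  | C_mul_T d α =>
    simp only [symbolEval_C_mul_T, intervalIntegral.integral_mul_const]
    rw [intervalIntegral.integral_const_mul, mul_left_comm, integral_exp_two_I, coeff_C_mul_T]
    split_ifs <;> simp

/-! ### Means of functions of a symbol -/

/-- The mean `(1/2π) ∫_{-π}^{π} ∫_0^1 f(w(t) h(φ)) dt dφ`. -/
noncomputable def symbolMean (f w h : ℝ → ℝ) : ℝ :=
  1 / (2 * π) * ∫ φ in (-π)..π, ∫ t in (0 : ℝ)..1, f (w t * h φ)

section SymbolMean

variable {f g w h : ℝ → ℝ}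

lemma continuous_inner_mean (hf : Continuous f) (hw : Continuous w) (hh : Continuous h) :
    Continuous fun φ => ∫ t in (0 : ℝ)..1, f (w t * h φ) :=
  intervalIntegral.continuous_parametric_intervalIntegral_of_continuous' (μ := volume)
    (f := fun φ t => f (w t * h φ)) (by fun_prop) 0 1

lemma symbolMean_sub (hf : Continuous f) (hg : Continuous g) (hw : Continuous w)
    (hh : Continuous h) :
    symbolMean (fun x => f x - g x) w h = symbolMean f w h - symbolMean g w h := by
  have h1 : ∀ φ, ∫ t in (0 : ℝ)..1, (f (w t * h φ) - g (w t * h φ)) =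
      (∫ t in (0 : ℝ)..1, f (w t * h φ)) - ∫ t in (0 : ℝ)..1, g (w t * h φ) := fun φ =>
    intervalIntegral.integral_sub (by apply Continuous.intervalIntegrable; fun_prop)
      (by apply Continuous.intervalIntegrable; fun_prop)
  simp only [symbolMean, h1]
  rw [intervalIntegral.integral_sub ((continuous_inner_mean hf hw hh).intervalIntegrable _ _)
    ((continuous_inner_mean hg hw hh).intervalIntegrable _ _), mul_sub]

lemma symbolMean_add (hf : Continuous f) (hg : Continuous g) (hw : Continuous w)
    (hh : Continuous h) :
    symbolMean (fun x => f x + g x) w h = symbolMean f w h + symbolMean g w h := by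
  have h1 := symbolMean_sub (f := fun x => f x + g x) (by fun_prop) hg hw hh
  simp only [add_sub_cancel_right] at h1
  linarith

lemma symbolMean_const_mul (c : ℝ) (f w h : ℝ → ℝ) :
    symbolMean (fun x => c * f x) w h = c * symbolMean f w h := by
  simp only [symbolMean, intervalIntegral.integral_const_mul]; ring

lemma abs_symbolMean_le {ε : ℝ} (hf : ∀ t ∈ Icc (0 : ℝ) 1, ∀ φ, |f (w t * h φ)| ≤ ε) :
    |symbolMean f w h| ≤ ε := by
  rw [symbolMean, abs_mul, abs_of_pos (by positivity : 0 < 1 / (2 * π))]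
  have h1 : ∀ φ, ‖∫ t in (0 : ℝ)..1, f (w t * h φ)‖ ≤ ε := fun φ => by
    have := intervalIntegral.norm_integral_le_of_norm_le_const (a := (0 : ℝ)) (b := 1) (C := ε)
      (f := fun t => f (w t * h φ)) fun t ht => by
        rw [uIoc_of_le zero_le_one] at ht
        exact hf t ⟨ht.1.le, ht.2⟩ φ
    simpa using this
  have h2 := intervalIntegral.norm_integral_le_of_norm_le_const (a := -π) (b := π) (C := ε)
    (f := fun φ => ∫ t in (0 : ℝ)..1, f (w t * h φ)) fun φ _ => h1 φ
  rw [Real.norm_eq_abs, abs_of_pos (by linarith [Real.pi_pos] : 0 < π - -π)] at h2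
  calc _ ≤ 1 / (2 * π) * (ε * (π - -π)) := by gcongr
    _ = ε := by field_simp; ring

end SymbolMean

/-- `G` as a complex-valued continuous function. -/
def toComplexMap (G : C(ℝ, ℝ)) : C(ℝ, ℂ) := ⟨fun t => (G t : ℂ), by fun_prop⟩

/-! ### The Szegő theorem for continuous weights and trigonometric polynomials -/

section Szego

variable {G : C(ℝ, ℝ)} {h : ℝ → ℝ} {p : LaurentPolynomial C(ℝ, ℂ)}

lemma opMat_C (α : C(ℝ, ℂ)) (n : ℕ) :
    opMat (LaurentPolynomial.C α) n = Matrix.diagonal fun i : Fin n => α ((i : ℝ) / n) := by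
  ext i j
  have := opMat_C_mul_T 0 α n i j
  rw [LaurentPolynomial.T_zero, mul_one] at this
  rw [this, Matrix.diagonal_apply]
  congr 1
  exact propext ⟨fun h => Fin.ext (by omega), fun h => by simp [h]⟩

/-- The weights `G(i/n)` and `G(j/n)` are diagonal factors on the left and on the right. Replacing
the product by the single symbol `G²h` costs only a negligible sequence. -/
lemma toepMat_eq_opMat_mul (hp : ∀ t φ, symbolEval t φ p = h φ) (n : ℕ) :
    toepMat (fun j : Fin n => G (j / n)) h = opMat (LaurentPolynomial.C (toComplexMap G)) n *
      opMat p n * opMat (LaurentPolynomial.C (toComplexMap G)) n := by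
  ext i j
  rw [opMat_C, Matrix.mul_diagonal, Matrix.diagonal_mul, toepMat, opMat,
    ← fourierCoeff_symbolEval p ((i : ℝ) / n)]
  simp only [hp, toComplexMap, ContinuousMap.coe_mk]
  have : ∀ φ : ℝ, (h φ : ℂ) * Complex.exp (2 * Complex.I * (-((i : ℤ) - (j : ℤ)) : ℤ) * φ) =
      h φ * Complex.exp (2 * Complex.I * (j - i) * φ) := fun φ => by
    push_cast; ring_nf
  simp_rw [this]
  ring

lemma sumBounded_toepMat (hp : ∀ t φ, symbolEval t φ p = h φ) :
    SumBounded fun n => toepMat (fun j : Fin n => G (j / n)) h := by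
  simp_rw [toepMat_eq_opMat_mul hp]
  exact ((sumBounded_opMat _).mul (sumBounded_opMat _)).mul (sumBounded_opMat _)

lemma tendsto_trace_toepMat_pow (hp : ∀ t φ, symbolEval t φ p = h φ) (k : ℕ) :
    Tendsto (fun n : ℕ => (toepMat (fun j : Fin n => G (j / n)) h ^ k).trace / n) atTop
      (𝓝 (symbolMean (fun x => x ^ k) (fun t => G t ^ 2) h : ℂ)) := by
  set c := LaurentPolynomial.C (toComplexMap G) with hc
  have hself : ∀ a : LaurentPolynomial C(ℝ, ℂ), Negligible fun n => opMat a n - opMat a n :=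
    fun a => by simpa using negligible_zero
  have hneg : Negligible fun n => toepMat (fun j : Fin n => G (j / n)) h - opMat (c * p * c) n := by
    simp_rw [toepMat_eq_opMat_mul hp]
    exact negligible_mul_sub ((sumBounded_opMat _).mul (sumBounded_opMat _))
      (negligible_mul_sub (sumBounded_opMat _) (hself _) (hself _)) (hself _)
  have := tendsto_trace_pow (sumBounded_toepMat hp) hneg k
  rw [← integral_symbolEval] at this
  have hev : ∀ t φ, symbolEval t φ ((c * p * c) ^ k) = (((G t ^ 2 * h φ) ^ k : ℝ) : ℂ) := by
    intro t φ
    have h1 : symbolEval t φ c = G t := by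
      have := symbolEval_C_mul_T t φ (toComplexMap G) 0
      rw [LaurentPolynomial.T_zero, mul_one] at this
      rw [hc, this]
      simp [toComplexMap]
    rw [map_pow, map_mul, map_mul, h1, hp]
    push_cast
    ring
  simp only [hev, intervalIntegral.integral_ofReal] at this
  convert this using 2
  simp [symbolMean]

lemma sum_eigenvalues_pow {n : ℕ} {A : Matrix (Fin n) (Fin n) ℂ} (hA : A.IsHermitian) (k : ℕ) :
    ((∑ i, hA.eigenvalues i ^ k : ℝ) : ℂ) = (A ^ k).trace := by
  conv_rhs => rw [hA.spectral_theorem, ← map_pow, Unitary.conjStarAlgAut_apply,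
    Matrix.trace_mul_cycle]
  simp [Matrix.diagonal_pow, Matrix.trace_diagonal]

/-- Gershgorin: each eigenvalue lies in a disc about some `A k k` whose radius is the off-diagonal
row sum. -/
lemma abs_eigenvalues_le {n : ℕ} {A : Matrix (Fin n) (Fin n) ℂ} (hA : A.IsHermitian) {C : ℝ}
    (hC : ∀ i, ∑ j, ‖A i j‖ ≤ C) (i : Fin n) : |hA.eigenvalues i| ≤ C := by
  have hev : Module.End.HasEigenvalue (Matrix.toLin' A) (hA.eigenvalues i : ℂ) := by
    refine Module.End.hasEigenvalue_of_hasEigenvector (x := ⇑(hA.eigenvectorBasis i)) ⟨?_, ?_⟩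
    · rw [Module.End.mem_eigenspace_iff, Matrix.toLin'_apply, hA.mulVec_eigenvectorBasis]
      rfl
    · exact (WithLp.ofLp_eq_zero 2).ne.2 (hA.eigenvectorBasis.orthonormal.ne_zero i)
  obtain ⟨k, hk⟩ := eigenvalue_mem_ball hev
  rw [Metric.mem_closedBall, dist_eq_norm] at hk
  calc |hA.eigenvalues i| = ‖(hA.eigenvalues i : ℂ)‖ := by simp
    _ ≤ ‖(hA.eigenvalues i : ℂ) - A k k‖ + ‖A k k‖ := norm_le_norm_sub_add _ _
    _ ≤ ∑ j ∈ Finset.univ.erase k, ‖A k j‖ + ‖A k k‖ := by gcongr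
    _ = ∑ j, ‖A k j‖ := Finset.sum_erase_add _ _ (Finset.mem_univ k)
    _ ≤ C := hC k

lemma tendsto_average_polynomial (hh : Continuous h) (hp : ∀ t φ, symbolEval t φ p = h φ)
    (q : ℝ[X]) :
    Tendsto (fun n : ℕ => (∑ i, q.eval
      ((isHermitian_toepMat (fun j : Fin n => G (j / n)) h).eigenvalues i)) / n) atTop
      (𝓝 (symbolMean (fun x => q.eval x) (fun t => G t ^ 2) h)) := by
  induction q using Polynomial.induction_on' with
  | add q r hq hr =>
    simp only [Polynomial.eval_add]
    rw [symbolMean_add (by fun_prop) (by fun_prop) (by fun_prop) hh]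
    refine (hq.add hr).congr fun n => ?_
    rw [Finset.sum_add_distrib, add_div]
  | monomial k c =>
    simp only [Polynomial.eval_monomial]
    rw [symbolMean_const_mul]
    have h1 := (Complex.continuous_re.tendsto _).comp (tendsto_trace_toepMat_pow (G := G) hp k)
    refine (h1.const_mul c).congr fun n => ?_
    simp only [Function.comp_apply]
    rw [← sum_eigenvalues_pow (isHermitian_toepMat _ _), ← Complex.ofReal_natCast,
      ← Complex.ofReal_div, Complex.ofReal_re, ← Finset.mul_sum]
    ring

/-- A Szegő limit theorem for variable-coefficient Toeplitz matrices. -/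
theorem tendsto_average_toepMat (hh : Continuous h) (hp : ∀ t φ, symbolEval t φ p = h φ)
    {H : ℝ} (hH : ∀ φ, |h φ| ≤ H) {f : ℝ → ℝ} (hf : Continuous f) :
    Tendsto (fun n : ℕ => (∑ i, f
      ((isHermitian_toepMat (fun j : Fin n => G (j / n)) h).eigenvalues i)) / n) atTop
      (𝓝 (symbolMean f (fun t => G t ^ 2) h)) := by
  obtain ⟨C, hC⟩ := sumBounded_toepMat (G := G) hp
  obtain ⟨D, hD⟩ := isCompact_Icc.exists_bound_of_continuousOn (s := Icc (0 : ℝ) 1)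
    (f := fun t => G t ^ 2) (by fun_prop)
  have hD0 : 0 ≤ D := (norm_nonneg _).trans (hD 0 (by simp))
  -- `[-R, R]` contains both the eigenvalues (row sums at most `C`) and the values of `G² h` for `t
  -- ∈ [0, 1]`, so one polynomial approximation of `f` serves both sides.
  set R := max C (D * H) with hR
  rw [Metric.tendsto_atTop]
  intro ε hε
  obtain ⟨q, hq⟩ := exists_polynomial_near_of_continuousOn (-R) R f hf.continuousOn (ε / 4)
    (by positivity)
  obtain ⟨N, hN⟩ := Metric.tendsto_atTop.1 (tendsto_average_polynomial (G := G) hh hp q) (ε / 4)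
    (by positivity)
  refine ⟨N, fun n hn => ?_⟩
  have h1 : |symbolMean f (fun t => G t ^ 2) h -
      symbolMean (fun x => q.eval x) (fun t => G t ^ 2) h| ≤ ε / 4 := by
    rw [← symbolMean_sub hf (by fun_prop) (by fun_prop) hh]
    refine abs_symbolMean_le fun t ht φ => ?_
    have hb : |G t ^ 2 * h φ| ≤ R := by
      rw [abs_mul]
      exact (mul_le_mul (hD t ht) (hH φ) (abs_nonneg _) hD0).trans (le_max_right _ _)
    rw [abs_sub_comm]
    exact (hq _ (abs_le.1 hb)).le
  set μ := (isHermitian_toepMat (fun j : Fin n => G (j / n)) h).eigenvalues with hμ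
  have h2 : |(∑ i, f (μ i)) / n - (∑ i, q.eval (μ i)) / n| ≤ ε / 4 := by
    rw [← sub_div, ← Finset.sum_sub_distrib, abs_div, abs_of_nonneg (Nat.cast_nonneg n : (0:ℝ) ≤ n)]
    refine div_le_of_le_mul₀ (by positivity) (by positivity) ?_
    refine (Finset.abs_sum_le_sum_abs _ _).trans ?_
    refine (Finset.sum_le_card_nsmul _ _ (ε / 4) fun i _ => ?_).trans (by simp [mul_comm])
    have hb : |μ i| ≤ R := (abs_eigenvalues_le _ (hC n).1 i).trans (le_max_left _ _)
    rw [abs_sub_comm]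
    exact (hq _ (abs_le.1 hb)).le
  have h3 := hN n hn
  rw [Real.dist_eq] at h3 ⊢
  rw [abs_lt] at h3 ⊢
  rw [abs_le] at h1 h2
  constructor <;> linarith [h1.1, h1.2, h2.1, h2.2, h3.1, h3.2]

end Szego

/-! ### Central binomial coefficients and the limit profile of the weights -/

/-- The normalised central binomial coefficient `(2a choose a) / 4^a`. -/
noncomputable def centralRatio (a : ℕ) : ℝ := a.centralBinom / 4 ^ a

lemma centralRatio_pos (a : ℕ) : 0 < centralRatio a := by
  have := Nat.centralBinom_pos a
  unfold centralRatio; positivity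

/-- Links central binomials to Wallis' partial products: `W a → π/2` gives the asymptotics
`1/√(πa)`, and `W a ≥ 1` gives a uniform bound. -/
lemma centralRatio_sq (a : ℕ) : centralRatio a ^ 2 = 1 / ((2 * a + 1) * Real.Wallis.W a) := by
  rw [Real.Wallis.W_eq_factorial_ratio, centralRatio, Nat.centralBinom_eq_two_mul_choose,
    Nat.choose_eq_factorial_div_factorial (by omega), show 2 * a - a = a by omega,
    Nat.cast_div (by simpa [two_mul] using Nat.factorial_mul_factorial_dvd_factorial_add a a)
      (by positivity)]
  have h2 : (2 : ℝ) ^ (4 * a) = (4 ^ a) ^ 2 := by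
    rw [← pow_mul, show (4 : ℝ) = 2 ^ 2 by norm_num, ← pow_mul]; ring_nf
  rw [h2]
  push_cast
  field_simp

lemma one_le_W (a : ℕ) : 1 ≤ Real.Wallis.W a := by
  induction a with
  | zero => simp [Real.Wallis.W]
  | succ a ih =>
    rw [Real.Wallis.W_succ]
    refine one_le_mul_of_one_le_of_one_le ih ?_
    rw [div_mul_div_comm, one_le_div (by positivity)]
    nlinarith

lemma centralRatio_le (a : ℕ) : centralRatio a ≤ 1 / √(a + 1) := by
  have h : centralRatio a ^ 2 ≤ (1 / √((a : ℝ) + 1)) ^ 2 := by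
    rw [centralRatio_sq, div_pow, Real.sq_sqrt (by positivity), one_pow]
    have := one_le_W a
    have ha : (0 : ℝ) ≤ a := Nat.cast_nonneg a
    gcongr
    nlinarith
  exact le_of_sq_le_sq h (by positivity)

lemma tendsto_centralRatio :
    Tendsto (fun a : ℕ => centralRatio a * √(a + 1)) atTop (𝓝 (1 / √π)) := by
  have h1 : Tendsto (fun a : ℕ => ((a : ℝ) + 1) / (2 * a + 1)) atTop (𝓝 (1 / 2)) := by
    have h0 : Tendsto (fun a : ℕ => (1 : ℝ) / ((2 * a + 1 : ℕ) : ℝ)) atTop (𝓝 0) :=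
      (tendsto_const_div_atTop_nhds_zero_nat (1 : ℝ)).comp
        (tendsto_atTop_mono (fun a => by simp only [id]; omega) tendsto_id)
    have := (h0.const_mul (1 / 2)).const_add (1 / 2)
    simp only [mul_zero, add_zero] at this
    refine this.congr fun a => ?_
    push_cast
    field_simp
    ring
  have h2 := (h1.mul (Real.Wallis.tendsto_W_nhds_pi_div_two.inv₀ (by positivity))).sqrt
  have h3 : √(1 / 2 * (π / 2)⁻¹) = 1 / √π := by
    rw [show (1 / 2 * (π / 2)⁻¹ : ℝ) = 1 / π by field_simp, Real.sqrt_div zero_le_one,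
      Real.sqrt_one]
  rw [h3] at h2
  refine h2.congr fun a => ?_
  have hW := Real.Wallis.W_pos a
  rw [← Real.sqrt_sq (centralRatio_pos a).le, ← Real.sqrt_mul (sq_nonneg _), centralRatio_sq]
  congr 1
  field_simp

/-- The modulus of the `j`-th basis function on the equator (times `√(2π)`), for `ℓ = n - 1`. -/
noncomputable def weight (n j : ℕ) : ℝ :=
  √((2 * n - 1) * (centralRatio j * centralRatio (n - 1 - j)))

/-- The limit profile `2 / (π √(t(1-t)))` of the squared weights. -/
noncomputable def profile (t : ℝ) : ℝ := 2 / (π * √(t * (1 - t)))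

lemma profile_nonneg (t : ℝ) : 0 ≤ profile t := by unfold profile; positivity

section Weights

variable {t : ℝ}

lemma floor_mul_lt (ht : t ∈ Ioo (0 : ℝ) 1) {n : ℕ} (hn : n ≠ 0) : ⌊n * t⌋₊ < n := by
  have hn' : (0 : ℝ) < n := by positivity
  rw [Nat.floor_lt (by have := ht.1; positivity)]
  nlinarith [ht.2]

lemma weight_sq {n j : ℕ} (hn : n ≠ 0) :
    weight n j ^ 2 = (2 * n - 1) * (centralRatio j * centralRatio (n - 1 - j)) := by
  have h1 : (1 : ℝ) ≤ n := by exact_mod_cast Nat.one_le_iff_ne_zero.2 hn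
  have := centralRatio_pos j
  have := centralRatio_pos (n - 1 - j)
  exact Real.sq_sqrt (mul_nonneg (by linarith) (by positivity))

lemma weight_zero (j : ℕ) : weight 0 j = 0 := by
  have := centralRatio_pos j
  have := centralRatio_pos (0 - 1 - j)
  refine Real.sqrt_eq_zero_of_nonpos ?_
  have : 0 < centralRatio j * centralRatio (0 - 1 - j) := by positivity
  push_cast
  linarith

/-- An integrable majorant uniform in `n`: with `j = ⌊nt⌋`, both `j + 1 ≥ nt` and `n - j ≥ n(1 - t)`
enter the bounds for the two binomial factors. -/
lemma weight_sq_le (ht : t ∈ Ioo (0 : ℝ) 1) (n : ℕ) :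
    weight n ⌊n * t⌋₊ ^ 2 ≤ 2 / √(t * (1 - t)) := by
  rcases eq_or_ne n 0 with rfl | hn
  · rw [weight_zero, zero_pow two_ne_zero]; positivity
  have hn' : (0 : ℝ) < n := by positivity
  have ht0 := ht.1
  have ht1 : 0 < 1 - t := by linarith [ht.2]
  rw [weight_sq hn]
  set j := ⌊n * t⌋₊ with hj
  have hjn : j < n := floor_mul_lt ht hn
  have h1 : centralRatio j ≤ 1 / √(n * t) :=
    (centralRatio_le j).trans (by gcongr; exact (Nat.lt_floor_add_one _).le)
  have h2 : centralRatio (n - 1 - j) ≤ 1 / √(n * (1 - t)) := by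
    refine (centralRatio_le _).trans ?_
    have h3 : ((n - 1 - j : ℕ) : ℝ) + 1 = n - j := by
      rw [Nat.sub_sub, Nat.cast_sub (by omega)]; push_cast; ring
    rw [h3]
    gcongr
    have := Nat.floor_le (show 0 ≤ n * t by positivity)
    linarith
  have h4 := (centralRatio_pos j).le
  have h5 := (centralRatio_pos (n - 1 - j)).le
  have h6 : √(n * t) * √(n * (1 - t)) = n * √(t * (1 - t)) := by
    rw [← Real.sqrt_mul (by positivity), show (n : ℝ) * t * (n * (1 - t)) = n ^ 2 * (t * (1 - t)) by
      ring, Real.sqrt_mul (by positivity), Real.sqrt_sq hn'.le]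
  calc (2 * n - 1) * (centralRatio j * centralRatio (n - 1 - j))
      ≤ (2 * n) * (1 / √(n * t) * (1 / √(n * (1 - t)))) := by
        gcongr; linarith
    _ = 2 / √(t * (1 - t)) := by
        rw [one_div_mul_one_div, h6]; field_simp

lemma tendsto_floor_mul_atTop (ht : 0 < t) : Tendsto (fun n : ℕ => ⌊n * t⌋₊) atTop atTop :=
  tendsto_nat_floor_atTop.comp (tendsto_natCast_atTop_atTop.atTop_mul_const ht)

lemma tendsto_weight_sq (ht : t ∈ Ioo (0 : ℝ) 1) :
    Tendsto (fun n : ℕ => weight n ⌊n * t⌋₊ ^ 2) atTop (𝓝 (profile t)) := by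
  have ht0 := ht.1
  have ht1 : 0 < 1 - t := by linarith [ht.2]
  have hinv : Tendsto (fun n : ℕ => (1 : ℝ) / n) atTop (𝓝 0) :=
    tendsto_const_div_atTop_nhds_zero_nat 1
  have hj := tendsto_floor_mul_div ht0.le
  have hcomp : Tendsto (fun n : ℕ => n - 1 - ⌊n * t⌋₊) atTop atTop := by
    refine tendsto_atTop_mono (fun n => ?_) ((tendsto_sub_atTop_nat 1).comp
      (tendsto_floor_mul_atTop ht1))
    have h1 : ⌊n * t⌋₊ + ⌊n * (1 - t)⌋₊ ≤ n := by
      have ha := Nat.floor_le (show 0 ≤ n * t by positivity)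
      have hb := Nat.floor_le (show 0 ≤ n * (1 - t) by positivity)
      have : ((⌊n * t⌋₊ + ⌊n * (1 - t)⌋₊ : ℕ) : ℝ) ≤ n := by push_cast; linarith
      exact_mod_cast this
    simp only [Function.comp_apply]
    omega
  have h1 := tendsto_centralRatio.comp (tendsto_floor_mul_atTop ht0)
  have h2 := tendsto_centralRatio.comp hcomp
  -- The quotient `(2n - 1) / (√(j+1) √(n-j))`, with `n` divided out, left over when each binomial
  -- factor is multiplied by its square root.
  have h3 : Tendsto (fun n : ℕ => (2 - 1 / (n : ℝ)) / (√((⌊n * t⌋₊ : ℝ) / n + 1 / n) *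
      √(1 - (⌊n * t⌋₊ : ℝ) / n))) atTop (𝓝 ((2 - 0) / (√(t + 0) * √(1 - t)))) := by
    refine (hinv.const_sub 2).div ((hj.add hinv).sqrt.mul (hj.const_sub 1).sqrt) ?_
    rw [add_zero]; positivity
  have h4 := h3.mul (h1.mul h2)
  have h5 : (2 - 0) / (√(t + 0) * √(1 - t)) * (1 / √π * (1 / √π)) = profile t := by
    rw [one_div_mul_one_div, Real.mul_self_sqrt Real.pi_pos.le, profile, add_zero, sub_zero,
      Real.sqrt_mul ht0.le]
    field_simp
  rw [h5] at h4
  refine h4.congr' ?_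
  filter_upwards [eventually_ne_atTop 0] with n hn
  have hn' : (0 : ℝ) < n := by positivity
  rw [weight_sq hn]
  simp only [Function.comp_apply]
  set j := ⌊n * t⌋₊ with hjd
  have hjn : j < n := floor_mul_lt ht hn
  have hjn' : (j : ℝ) < n := by exact_mod_cast hjn
  have h6 : ((n - 1 - j : ℕ) : ℝ) + 1 = n - j := by
    rw [Nat.sub_sub, Nat.cast_sub (by omega)]; push_cast; ring
  have h7 : 0 < (n : ℝ) - j := by linarith
  rw [h6, ← add_div, Real.sqrt_div (by positivity),
    show 1 - (j : ℝ) / n = (n - j) / n by field_simp, Real.sqrt_div h7.le,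
    div_mul_div_comm, Real.mul_self_sqrt hn'.le]
  field_simp

lemma tendsto_weight (ht : t ∈ Ioo (0 : ℝ) 1) :
    Tendsto (fun n : ℕ => weight n ⌊n * t⌋₊) atTop (𝓝 √(profile t)) := by
  refine (tendsto_weight_sq ht).sqrt.congr fun n => ?_
  exact Real.sqrt_sq (Real.sqrt_nonneg _)

/-- Separates the two endpoint singularities; it amounts to `1 ≤ √t + √(1-t)`. -/
lemma inv_sqrt_le (ht : t ∈ Ioo (0 : ℝ) 1) :
    1 / √(t * (1 - t)) ≤ t ^ (-1 / 2 : ℝ) + (1 - t) ^ (-1 / 2 : ℝ) := by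
  have ht0 := ht.1
  have ht1 : 0 < 1 - t := by linarith [ht.2]
  have h : ∀ x : ℝ, 0 < x → x ^ (-1 / 2 : ℝ) = 1 / √x := fun x hx => by
    rw [Real.sqrt_eq_rpow, neg_div, Real.rpow_neg hx.le, one_div, one_div]
  rw [h t ht0, h _ ht1, Real.sqrt_mul ht0.le]
  have h1 : 0 < √t := Real.sqrt_pos.2 ht0
  have h2 : 0 < √(1 - t) := Real.sqrt_pos.2 ht1
  rw [div_add_div _ _ h1.ne' h2.ne']
  gcongr
  nlinarith [Real.sq_sqrt ht0.le, Real.sq_sqrt ht1.le, mul_pos h1 h2]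

lemma intervalIntegrable_inv_sqrt :
    IntervalIntegrable (fun t : ℝ => 1 / √(t * (1 - t))) volume 0 1 := by
  have h1 : IntervalIntegrable (fun t : ℝ => t ^ (-1 / 2 : ℝ)) volume 0 1 :=
    intervalIntegral.intervalIntegrable_rpow' (by norm_num)
  have h2 : IntervalIntegrable (fun t : ℝ => (1 - t) ^ (-1 / 2 : ℝ)) volume 0 1 := by
    simpa using (h1.comp_sub_left 1).symm
  refine (h1.add h2).mono_fun' (by
    apply Measurable.aestronglyMeasurable; fun_prop) ?_
  have hae : ∀ᵐ t : ℝ, t ≠ 1 := by simp [ae_iff]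
  filter_upwards [ae_restrict_mem measurableSet_uIoc, ae_restrict_of_ae hae] with t ht ht1
  rw [uIoc_of_le zero_le_one] at ht
  rw [Real.norm_eq_abs, abs_of_nonneg (by positivity)]
  exact inv_sqrt_le ⟨ht.1, lt_of_le_of_ne ht.2 ht1⟩

lemma intervalIntegrable_profile : IntervalIntegrable profile volume 0 1 := by
  refine (intervalIntegrable_inv_sqrt.const_mul (2 / π)).congr (fun t _ => ?_)
  simp only [profile]
  rw [div_mul_div_comm, mul_one]

lemma measurable_profile : Measurable profile := by unfold profile; fun_prop

lemma tendsto_average_weight_sq :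
    Tendsto (fun n : ℕ => (∑ j : Fin n, weight n j ^ 2) / n) atTop
      (𝓝 (∫ t in (0 : ℝ)..1, profile t)) := by
  refine (tendsto_average (fun n j => weight n j ^ 2) profile _
    (intervalIntegrable_inv_sqrt.const_mul 2) (fun n t ht => ?_)
    fun t ht => tendsto_weight_sq ht).congr fun n => ?_
  · rw [Real.norm_eq_abs, abs_of_nonneg (sq_nonneg _), mul_one_div]
    exact weight_sq_le ht n
  · rw [← Fin.sum_univ_eq_sum_range fun j => weight n j ^ 2, smul_eq_mul]
    ring

lemma tendsto_average_weight_sub_sq (G : C(ℝ, ℝ)) :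
    Tendsto (fun n : ℕ => (∑ j : Fin n, (weight n j - G (j / n)) ^ 2) / n) atTop
      (𝓝 (∫ t in (0 : ℝ)..1, (√(profile t) - G t) ^ 2)) := by
  obtain ⟨C, hC⟩ := isCompact_Icc.exists_bound_of_continuousOn (s := Icc (0 : ℝ) 1)
    G.continuous.continuousOn
  have hb : IntervalIntegrable (fun t : ℝ => 4 * (1 / √(t * (1 - t))) + 2 * C ^ 2) volume 0 1 :=
    (intervalIntegrable_inv_sqrt.const_mul 4).add intervalIntegrable_const
  refine (tendsto_average (fun n j => (weight n j - G (j / n)) ^ 2)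
    (fun t => (√(profile t) - G t) ^ 2) _ hb (fun n t ht => ?_) fun t ht => ?_).congr fun n => ?_
  · rw [Real.norm_eq_abs, abs_of_nonneg (sq_nonneg _)]
    have h1 := weight_sq_le ht n
    have h2 : G (⌊n * t⌋₊ / n) ^ 2 ≤ C ^ 2 := by
      rw [← sq_abs]
      gcongr
      exact hC _ (floor_mul_div_mem ht n)
    rw [← mul_one_div] at h1
    nlinarith [sq_nonneg (weight n ⌊n * t⌋₊ + G (⌊n * t⌋₊ / n))]
  · exact ((tendsto_weight ht).sub ((G.continuous.tendsto t).comp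
      (tendsto_floor_mul_div ht.1.le))).pow 2
  · rw [← Fin.sum_univ_eq_sum_range fun j => (weight n j - G (j / n)) ^ 2, smul_eq_mul]
    ring

end Weights

/-! ### Approximation of the profile and of periodic functions -/

/-- The profile is approximated in mean by squares of continuous functions. -/
lemma exists_continuous_approx {ε : ℝ} (hε : 0 < ε) :
    ∃ G : C(ℝ, ℝ), ∫ t in (0 : ℝ)..1, (√(profile t) - G t) ^ 2 < ε := by
  have hpos : ∀ (m : ℕ) (t : ℝ), 0 < max (t * (1 - t)) 0 + 1 / ((m : ℝ) + 1) := fun m t => by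
    positivity
  have hcont : ∀ m : ℕ,
      Continuous fun t : ℝ => √(2 / (π * √(max (t * (1 - t)) 0 + 1 / ((m : ℝ) + 1)))) := by
    intro m
    refine Continuous.sqrt (Continuous.div (by fun_prop) (by fun_prop) fun t => ?_)
    have := hpos m t
    positivity
  -- Adding `1/(m+1)` under the inner root removes the singularities and keeps `G m` below
  -- `√profile` on `(0, 1)`, so `profile` dominates the squared difference.
  set G : ℕ → C(ℝ, ℝ) := fun m => ⟨_, hcont m⟩ with hG
  have hGle : ∀ m, ∀ t ∈ Ioo (0 : ℝ) 1, G m t ≤ √(profile t) := by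
    intro m t ht
    have h1 : 0 < t * (1 - t) := mul_pos ht.1 (by linarith [ht.2])
    simp only [hG, ContinuousMap.coe_mk, profile, max_eq_left h1.le]
    gcongr
    have : (0 : ℝ) < 1 / (m + 1) := by positivity
    linarith
  have hGlim : ∀ t ∈ Ioo (0 : ℝ) 1, Tendsto (fun m => G m t) atTop (𝓝 √(profile t)) := by
    intro t ht
    have h1 : 0 < t * (1 - t) := mul_pos ht.1 (by linarith [ht.2])
    simp only [hG, ContinuousMap.coe_mk, profile, max_eq_left h1.le]
    have h2 := (tendsto_one_div_add_atTop_nhds_zero_nat (𝕜 := ℝ)).const_add (t * (1 - t))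
    rw [add_zero] at h2
    exact (tendsto_const_nhds.div (h2.sqrt.const_mul π) (by positivity)).sqrt
  have hae : ∀ᵐ t : ℝ, t ≠ 1 := by simp [ae_iff]
  have hlim : Tendsto (fun m => ∫ t in (0 : ℝ)..1, (√(profile t) - G m t) ^ 2) atTop
      (𝓝 (∫ t in (0 : ℝ)..1, (0 : ℝ))) := by
    refine intervalIntegral.tendsto_integral_filter_of_dominated_convergence profile ?_ ?_
      intervalIntegrable_profile ?_
    · refine Eventually.of_forall fun m => ?_
      have := measurable_profile
      have := (G m).continuous.measurable
      apply Measurable.aestronglyMeasurable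
      fun_prop
    · refine Eventually.of_forall fun m => ?_
      filter_upwards [hae] with t ht htm
      rw [uIoc_of_le zero_le_one] at htm
      have h1 := hGle m t ⟨htm.1, lt_of_le_of_ne htm.2 ht⟩
      have h2 : 0 ≤ G m t := Real.sqrt_nonneg _
      rw [Real.norm_eq_abs, abs_of_nonneg (sq_nonneg _)]
      nlinarith [Real.sq_sqrt (profile_nonneg t), Real.sqrt_nonneg (profile t)]
    · filter_upwards [hae] with t ht htm
      rw [uIoc_of_le zero_le_one] at htm
      simpa using ((hGlim t ⟨htm.1, lt_of_le_of_ne htm.2 ht⟩).const_sub √(profile t)).pow 2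
  rw [intervalIntegral.integral_zero] at hlim
  obtain ⟨m, hm⟩ := (hlim.eventually (gt_mem_nhds hε)).exists
  exact ⟨G m, hm⟩

lemma symbolEval_C (t φ : ℝ) (α : C(ℝ, ℂ)) :
    symbolEval t φ (LaurentPolynomial.C α) = α t := by
  have := symbolEval_C_mul_T t φ α 0
  simpa using this

/-- Trigonometric polynomials in `2φ` are dense in the continuous `π`-periodic functions. -/
lemma exists_trigPoly_near {g : ℝ → ℝ} (hg : Continuous g) (hper : Function.Periodic g π) {ε : ℝ}
    (hε : 0 < ε) : ∃ (h : ℝ → ℝ) (p : LaurentPolynomial C(ℝ, ℂ)), Continuous h ∧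
      (∀ t φ, symbolEval t φ p = h φ) ∧ ∀ φ, |g φ - h φ| ≤ ε := by
  have : Fact (0 < π) := ⟨Real.pi_pos⟩
  have hlift : ∀ φ : ℝ, hper.lift (φ : AddCircle π) = g φ := fun φ => hper.lift_coe φ
  have hcont : Continuous (hper.lift : AddCircle π → ℝ) := by
    refine continuous_coinduced_dom.2 ?_
    exact hg
  set F : C(AddCircle π, ℂ) := ⟨fun x => (hper.lift x : ℂ), by fun_prop⟩ with hF
  have hmem : F ∈ (Submodule.span ℂ (range (@fourier π))).topologicalClosure := by
    rw [span_fourier_closure_eq_top]; trivial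
  obtain ⟨P, hP, hPε⟩ := Metric.mem_closure_iff.1 hmem ε hε
  -- Both `P` and its conjugate are symbols, hence so is `Re P`, which approximates the real `g` at
  -- least as well as `P`.
  have key : ∃ p q : LaurentPolynomial C(ℝ, ℂ), ∀ t φ : ℝ,
      symbolEval t φ p = P (φ : AddCircle π) ∧ symbolEval t φ q = conj (P (φ : AddCircle π)) := by
    refine Submodule.span_induction (p := fun P _ => ∃ p q : LaurentPolynomial C(ℝ, ℂ),
      ∀ t φ : ℝ, symbolEval t φ p = P (φ : AddCircle π) ∧
        symbolEval t φ q = conj (P (φ : AddCircle π))) ?_ ?_ ?_ ?_ hP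
    · rintro _ ⟨d, rfl⟩
      refine ⟨LaurentPolynomial.C 1 * LaurentPolynomial.T d,
        LaurentPolynomial.C 1 * LaurentPolynomial.T (-d), fun t φ => ?_⟩
      have h1 : fourier d (φ : AddCircle π) = Complex.exp (2 * Complex.I * d * φ) := by
        rw [fourier_coe_apply]
        congr 1
        have : (π : ℂ) ≠ 0 := by exact_mod_cast Real.pi_ne_zero
        field_simp
      rw [symbolEval_C_mul_T, symbolEval_C_mul_T, h1, ← Complex.exp_conj]
      constructor
      · simp
      · simp [Complex.conj_ofNat]
    · exact ⟨0, 0, by simp⟩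
    · rintro x y _ _ ⟨p, q, h⟩ ⟨p', q', h'⟩
      exact ⟨p + p', q + q', fun t φ => by simp [h, h']⟩
    · rintro c x _ ⟨p, q, h⟩
      exact ⟨LaurentPolynomial.C (ContinuousMap.const ℝ c) * p,
        LaurentPolynomial.C (ContinuousMap.const ℝ (conj c)) * q, fun t φ => by
          simp [h, symbolEval_C]⟩
  obtain ⟨p, q, hpq⟩ := key
  refine ⟨fun φ => (P (φ : AddCircle π)).re,
    LaurentPolynomial.C (ContinuousMap.const ℝ (1 / 2)) * (p + q), ?_, fun t φ => ?_, fun φ => ?_⟩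
  · exact Complex.continuous_re.comp (P.continuous.comp (AddCircle.continuous_mk' π))
  · rw [map_mul, map_add, symbolEval_C, (hpq t φ).1, (hpq t φ).2, Complex.add_conj]
    simp
  · have h1 := (ContinuousMap.dist_apply_le_dist (f := F) (g := P) (φ : AddCircle π)).trans hPε.le
    have h2 : g φ - (P (φ : AddCircle π)).re = (F (φ : AddCircle π) - P (φ : AddCircle π)).re := by
      simp [hF, hlift]
    rw [h2]
    exact (Complex.abs_re_le_norm _).trans (by rwa [dist_eq_norm] at h1)

/-! ### Stability of traces and symbol means under approximation -/

section Mean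

variable {f : ℝ → ℝ} {L : ℝ}

lemma continuous_of_abs_sub_le (hL : ∀ x y, |f x - f y| ≤ L * |x - y|) : Continuous f := by
  have : LipschitzWith L.toNNReal f := LipschitzWith.of_dist_le_mul fun x y => by
    rw [Real.dist_eq, Real.dist_eq]
    exact (hL x y).trans (by gcongr; exact Real.le_coe_toNNReal L)
  exact this.continuous

lemma intervalIntegrable_comp (hL : ∀ x y, |f x - f y| ≤ L * |x - y|) {w : ℝ → ℝ}
    (hw : IntervalIntegrable w volume 0 1) (y : ℝ) :
    IntervalIntegrable (fun t => f (w t * y)) volume 0 1 := by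
  have hf := continuous_of_abs_sub_le hL
  have hb : IntervalIntegrable (fun t => L * |w t * y| + |f 0|) volume 0 1 :=
    (((hw.mul_const y).abs).const_mul L).add intervalIntegrable_const
  refine hb.mono_fun' (hf.comp_aestronglyMeasurable
    (hw.mul_const y).def'.aestronglyMeasurable) ?_
  refine ae_of_all _ fun t => ?_
  have := hL (w t * y) 0
  rw [sub_zero] at this
  simp only [Real.norm_eq_abs]
  linarith [abs_sub_abs_le_abs_sub (f (w t * y)) (f 0)]

lemma abs_integral_comp_sub_le (hL : ∀ x y, |f x - f y| ≤ L * |x - y|) {w v : ℝ → ℝ}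
    (hw : IntervalIntegrable w volume 0 1) (hv : IntervalIntegrable v volume 0 1) (y z : ℝ) :
    |(∫ t in (0 : ℝ)..1, f (w t * y)) - ∫ t in (0 : ℝ)..1, f (v t * z)| ≤
      L * ∫ t in (0 : ℝ)..1, |w t * y - v t * z| := by
  rw [← intervalIntegral.integral_sub (intervalIntegrable_comp hL hw y)
    (intervalIntegrable_comp hL hv z), ← intervalIntegral.integral_const_mul]
  refine (intervalIntegral.abs_integral_le_integral_abs zero_le_one).trans ?_
  exact intervalIntegral.integral_mono zero_le_one
    ((intervalIntegrable_comp hL hw y).sub (intervalIntegrable_comp hL hv z)).abs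
    (((hw.mul_const y).sub (hv.mul_const z)).abs.const_mul L) fun t => hL _ _

lemma continuous_integral_comp (hL : ∀ x y, |f x - f y| ≤ L * |x - y|) {w : ℝ → ℝ}
    (hw : IntervalIntegrable w volume 0 1) :
    Continuous fun y => ∫ t in (0 : ℝ)..1, f (w t * y) := by
  refine continuous_of_abs_sub_le (L := L * ∫ t in (0 : ℝ)..1, |w t|) fun y z => ?_
  refine (abs_integral_comp_sub_le hL hw hw y z).trans (le_of_eq ?_)
  simp only [← mul_sub, abs_mul, intervalIntegral.integral_mul_const]
  ring

lemma abs_symbolMean_sub_le (hL : ∀ x y, |f x - f y| ≤ L * |x - y|) (hL0 : 0 ≤ L) {w v : ℝ → ℝ}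
    (hw : IntervalIntegrable w volume 0 1) (hv : IntervalIntegrable v volume 0 1) {g h : ℝ → ℝ}
    (hg : Continuous g) (hh : Continuous h) {K : ℝ}
    (hK : ∀ φ, ∫ t in (0 : ℝ)..1, |w t * g φ - v t * h φ| ≤ K) :
    |symbolMean f w g - symbolMean f v h| ≤ L * K := by
  have h1 : Continuous fun φ => ∫ t in (0 : ℝ)..1, f (w t * g φ) :=
    (continuous_integral_comp hL hw).comp hg
  have h2 : Continuous fun φ => ∫ t in (0 : ℝ)..1, f (v t * h φ) :=
    (continuous_integral_comp hL hv).comp hh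
  have h3 := intervalIntegral.norm_integral_le_of_norm_le_const (a := -π) (b := π) (C := L * K)
    (f := fun φ => (∫ t in (0 : ℝ)..1, f (w t * g φ)) - ∫ t in (0 : ℝ)..1, f (v t * h φ))
    fun φ _ => (abs_integral_comp_sub_le hL hw hv _ _).trans (by gcongr; exact hK φ)
  rw [Real.norm_eq_abs, abs_of_pos (by linarith [Real.pi_pos] : 0 < π - -π)] at h3
  rw [symbolMean, symbolMean, ← mul_sub, abs_mul, abs_of_pos (by positivity : 0 < 1 / (2 * π)),
    ← intervalIntegral.integral_sub (h1.intervalIntegrable _ _) (h2.intervalIntegrable _ _)]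
  calc _ ≤ 1 / (2 * π) * (L * K * (π - -π)) := by gcongr
    _ = L * K := by field_simp; ring

end Mean

lemma toEuclideanLin_eigenvectorBasis {n : ℕ} {A : Matrix (Fin n) (Fin n) ℂ} (hA : A.IsHermitian)
    (i : Fin n) : A.toEuclideanLin (hA.eigenvectorBasis i) =
      (hA.eigenvalues i : ℂ) • hA.eigenvectorBasis i := by
  rw [Matrix.toLpLin_apply, hA.mulVec_eigenvectorBasis]
  rfl

/-- `sum_eigenvalues_le` is applied twice with the roles exchanged; the diagonal estimate is
basis-independent, so it holds in either eigenbasis with the same constant. -/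
lemma abs_sum_eigenvalues_sub_le {n : ℕ} {f : ℝ → ℝ} (hf : ConvexOn ℝ univ f) {L : ℝ} (hL0 : 0 ≤ L)
    (hL : ∀ x y, |f x - f y| ≤ L * |x - y|) (s r : Fin n → ℝ) {g h : ℝ → ℝ}
    (hg : Continuous g) (hh : Continuous h) {ε H η : ℝ} (hgh : ∀ φ, |g φ - h φ| ≤ ε)
    (hH : ∀ φ, |h φ| ≤ H) (hη : 0 < η) :
    |∑ i, f ((isHermitian_toepMat s g).eigenvalues i) -
      ∑ i, f ((isHermitian_toepMat r h).eigenvalues i)| ≤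
      L * (ε * ∑ j, s j ^ 2 + H * ((1 + 1 / η) * ∑ j, (s j - r j) ^ 2 + η * ∑ j, s j ^ 2)) := by
  have hb := fun b : OrthonormalBasis (Fin n) ℂ (EuclideanSpace ℂ (Fin n)) =>
    sum_abs_toepForm_sub_le b s r hg hh hgh hH hη
  simp_rw [← inner_toepMat s hg, ← inner_toepMat r hh] at hb
  have hs := toEuclideanLin_eigenvectorBasis (isHermitian_toepMat s g)
  have hr := toEuclideanLin_eigenvectorBasis (isHermitian_toepMat r h)
  have h1 := sum_eigenvalues_le _ hs _ hr hf hL hL0 (hb _)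
  have h2 := sum_eigenvalues_le _ hr _ hs hf hL hL0
    ((Finset.sum_congr rfl fun i _ => abs_sub_comm _ _).trans_le (hb _))
  rw [abs_le]
  constructor <;> linarith

/-- The limiting counterpart of `sum_abs_toepForm_sub_le`, from the same pointwise inequality with
`P = √profile` and `Q = G`. -/
lemma integral_abs_profile_sub_le (G : C(ℝ, ℝ)) {g h ε H η : ℝ} (hgh : |g - h| ≤ ε)
    (hH : |h| ≤ H) (hη : 0 < η) :
    ∫ t in (0 : ℝ)..1, |profile t * g - G t ^ 2 * h| ≤
      ε * (∫ t in (0 : ℝ)..1, profile t) +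
        H * ((1 + 1 / η) * (∫ t in (0 : ℝ)..1, (√(profile t) - G t) ^ 2) +
          η * ∫ t in (0 : ℝ)..1, profile t) := by
  have hp := intervalIntegrable_profile
  have hG : IntervalIntegrable (fun t => G t ^ 2) volume 0 1 := by
    apply Continuous.intervalIntegrable; fun_prop
  have hd : IntervalIntegrable (fun t => (√(profile t) - G t) ^ 2) volume 0 1 := by
    refine ((hp.add hG).const_mul 2).mono_fun' ?_ (ae_of_all _ fun t => ?_)
    · have := measurable_profile
      have := G.continuous.measurable
      apply Measurable.aestronglyMeasurable
      fun_prop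
    · simp only [Real.norm_eq_abs]
      rw [abs_of_nonneg (sq_nonneg _)]
      nlinarith [Real.sq_sqrt (profile_nonneg t), sq_nonneg (√(profile t) + G t)]
  simp only [← intervalIntegral.integral_const_mul]
  rw [← intervalIntegral.integral_add (hd.const_mul _) (hp.const_mul _),
    ← intervalIntegral.integral_const_mul,
    ← intervalIntegral.integral_add (hp.const_mul _) (((hd.const_mul _).add (hp.const_mul _)).const_mul _)]
  refine intervalIntegral.integral_mono zero_le_one ((hp.mul_const g).sub (hG.mul_const h)).abs
    ((hp.const_mul _).add (((hd.const_mul _).add (hp.const_mul _)).const_mul _)) fun t => ?_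
  have h1 := abs_mul_sq_sub_mul_sq_le hgh hH hη (√(profile t) : ℂ) (G t : ℂ)
  rw [← Complex.ofReal_sub, Complex.norm_real, Complex.norm_real, Complex.norm_real,
    Real.norm_eq_abs, Real.norm_eq_abs, Real.norm_eq_abs, sq_abs, sq_abs, sq_abs,
    Real.sq_sqrt (profile_nonneg t)] at h1
  rwa [mul_comm (profile t), mul_comm (G t ^ 2)]

/-- The limit of averages of a convex Lipschitz function over the eigenvalues of the weighted
Toeplitz matrices. -/
theorem tendsto_average_eigenvalues {f : ℝ → ℝ} (hf : ConvexOn ℝ univ f) {L : ℝ} (hL0 : 0 ≤ L)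
    (hL : ∀ x y, |f x - f y| ≤ L * |x - y|) {g : ℝ → ℝ} (hg : Continuous g)
    (hper : Function.Periodic g π) :
    Tendsto (fun n : ℕ => (∑ i,
      f ((isHermitian_toepMat (fun j : Fin n => weight n j) g).eigenvalues i)) / n) atTop
      (𝓝 (symbolMean f profile g)) := by
  obtain ⟨Γ, hΓ⟩ : ∃ Γ, ∀ φ, |g φ| ≤ Γ := by
    obtain ⟨Γ, hΓ⟩ := isCompact_Icc.exists_bound_of_continuousOn (s := Icc (0 : ℝ) π)
      hg.continuousOn
    refine ⟨Γ, fun φ => ?_⟩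
    obtain ⟨y, hy, hφ⟩ := hper.exists_mem_Ico₀ Real.pi_pos φ
    rw [hφ]
    exact hΓ y ⟨hy.1, hy.2.le⟩
  have hΓ0 : 0 ≤ Γ := (abs_nonneg _).trans (hΓ 0)
  set W := ∫ t in (0 : ℝ)..1, profile t with hW
  have hW0 : 0 ≤ W := intervalIntegral.integral_nonneg zero_le_one fun t _ => profile_nonneg t
  set H := Γ + 1 with hHdef
  -- With `η = ε` and `L²` error below `ε²`, `(1 + 1/ε) ε² ≤ 2ε` makes the total error at most `ε *
  -- Q`.
  set Q := L * (W + H * (2 + W)) with hQ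
  have hQ0 : 0 ≤ Q := by positivity
  rw [Metric.tendsto_atTop]
  intro δ hδ
  obtain ⟨ε, hε0, hε1, hεQ⟩ : ∃ ε : ℝ, 0 < ε ∧ ε ≤ 1 ∧ ε * Q ≤ δ / 8 := by
    refine ⟨min 1 (δ / (8 * (Q + 1))), by positivity, min_le_left _ _, ?_⟩
    calc min 1 (δ / (8 * (Q + 1))) * Q ≤ δ / (8 * (Q + 1)) * (Q + 1) := by
          gcongr
          · exact min_le_right _ _
          · linarith
      _ = δ / 8 := by field_simp
  obtain ⟨h, p, hh, hp, hgh⟩ := exists_trigPoly_near hg hper hε0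
  obtain ⟨G, hG⟩ := exists_continuous_approx (show 0 < ε ^ 2 by positivity)
  have hH : ∀ φ, |h φ| ≤ H := fun φ => by
    have h1 := hgh φ
    have h2 := abs_sub_abs_le_abs_sub (h φ) (g φ)
    rw [abs_sub_comm] at h2
    linarith [hΓ φ]
  set E := ∫ t in (0 : ℝ)..1, (√(profile t) - G t) ^ 2 with hE
  set K := ε * W + H * ((1 + 1 / ε) * E + ε * W) with hK
  have hKle : L * K ≤ δ / 8 := by
    refine le_trans ?_ hεQ
    have h1 : (1 + 1 / ε) * E ≤ 2 * ε := by
      calc (1 + 1 / ε) * E ≤ (1 + 1 / ε) * ε ^ 2 := by gcongr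
        _ = ε ^ 2 + ε := by field_simp
        _ ≤ 2 * ε := by nlinarith
    calc L * K ≤ L * (ε * W + H * (2 * ε + ε * W)) := by
          rw [hK]; gcongr
      _ = ε * Q := by rw [hQ]; ring
  have hlimK : Tendsto (fun n : ℕ => L * (ε * ((∑ j : Fin n, weight n j ^ 2) / n) +
      H * ((1 + 1 / ε) * ((∑ j : Fin n, (weight n j - G (j / n)) ^ 2) / n) +
        ε * ((∑ j : Fin n, weight n j ^ 2) / n)))) atTop (𝓝 (L * K)) :=
    ((tendsto_average_weight_sq.const_mul ε).add ((((tendsto_average_weight_sub_sq G).const_mul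
      _).add (tendsto_average_weight_sq.const_mul ε)).const_mul H)).const_mul L
  have hlimJ := tendsto_average_toepMat (G := G) hh hp hH (continuous_of_abs_sub_le hL)
  have hIJ : |symbolMean f profile g - symbolMean f (fun t => G t ^ 2) h| ≤ L * K :=
    abs_symbolMean_sub_le hL hL0 intervalIntegrable_profile
      (by apply Continuous.intervalIntegrable; fun_prop) hg hh fun φ =>
        integral_abs_profile_sub_le G (hgh φ) (hH φ) hε0
  -- Three errors add up to less than `δ`: changing the matrices, the Szegő limit for `G` and `h`,
  -- and changing the symbol mean.
  obtain ⟨N, hN⟩ := eventually_atTop.1 ((hlimK.eventually (gt_mem_nhds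
    (show L * K < δ / 4 by linarith))).and (hlimJ.eventually (Metric.ball_mem_nhds _
      (show 0 < δ / 4 by positivity))))
  refine ⟨N, fun n hn => ?_⟩
  obtain ⟨h1, h2⟩ := hN n hn
  rw [Real.dist_eq] at h2 ⊢
  have h3 := abs_sum_eigenvalues_sub_le hf hL0 hL (fun j : Fin n => weight n j)
    (fun j : Fin n => G (j / n)) hg hh hgh hH hε0
  have h4 : |(∑ i, f ((isHermitian_toepMat (fun j : Fin n => weight n j) g).eigenvalues i)) / n -
      (∑ i, f ((isHermitian_toepMat (fun j : Fin n => G (j / n)) h).eigenvalues i)) / n| < δ / 4 := by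
    rw [← sub_div, abs_div, abs_of_nonneg (Nat.cast_nonneg n : (0 : ℝ) ≤ n)]
    refine lt_of_le_of_lt (div_le_div_of_nonneg_right h3 (Nat.cast_nonneg n)) (lt_of_eq_of_lt ?_ h1)
    ring
  rw [abs_lt] at h2 h4 ⊢
  rw [abs_le] at hIJ
  constructor <;> linarith [h2.1, h2.2, h4.1, h4.2, hIJ.1, hIJ.2]

/-! ### Norms and equatorial values of the associated Legendre functions -/

/-- The iterated derivative `(d/dx)^s (x² - 1)^ℓ`. -/
noncomputable def rodrigues (ℓ s : ℕ) : ℝ[X] :=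
  Polynomial.derivative^[s] ((Polynomial.X ^ 2 - 1) ^ ℓ : ℝ[X])

lemma derivative_rodrigues (ℓ s : ℕ) :
    Polynomial.derivative (rodrigues ℓ s) = rodrigues ℓ (s + 1) := by
  rw [rodrigues, rodrigues, Function.iterate_succ_apply']

/-- Obtained by differentiating `(x² - 1) u' = 2ℓ x u`, where `u = (x² - 1)^ℓ`, `s + 1` times. -/
lemma rodrigues_ode (ℓ s : ℕ) :
    (1 - Polynomial.X ^ 2) * rodrigues ℓ (s + 2) +
      Polynomial.C (2 * ((ℓ : ℝ) - s - 1)) * Polynomial.X * rodrigues ℓ (s + 1) +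
      Polynomial.C (((s : ℝ) + 1) * (2 * ℓ - s)) * rodrigues ℓ s = 0 := by
  induction s with
  | zero =>
    have h1 : (Polynomial.X ^ 2 - 1) * rodrigues ℓ 1 =
        Polynomial.C (2 * (ℓ : ℝ)) * Polynomial.X * rodrigues ℓ 0 := by
      rw [← derivative_rodrigues]
      simp only [rodrigues, Function.iterate_zero, id]
      cases ℓ with
      | zero => simp
      | succ ℓ =>
        rw [Polynomial.derivative_pow]
        simp only [Nat.add_sub_cancel, Polynomial.derivative_sub, Polynomial.derivative_X_pow,
          Polynomial.derivative_one, pow_succ (Polynomial.X ^ 2 - 1 : ℝ[X]) ℓ]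
        simp only [map_mul, map_ofNat, map_natCast]
        push_cast
        ring
    have h2 := congrArg Polynomial.derivative h1
    simp only [Polynomial.derivative_mul, derivative_rodrigues, Polynomial.derivative_sub,
      Polynomial.derivative_X_pow, Polynomial.derivative_one, Polynomial.derivative_C,
      Polynomial.derivative_X] at h2
    simp only [map_mul, map_sub, map_ofNat, map_one, map_natCast, Nat.cast_zero, map_zero,
      zero_add] at h2 ⊢
    push_cast at h2
    linear_combination -h2
  | succ s ih =>
    have h2 := congrArg Polynomial.derivative ih
    simp only [Polynomial.derivative_mul, derivative_rodrigues, Polynomial.derivative_sub,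
      Polynomial.derivative_X_pow, Polynomial.derivative_one, Polynomial.derivative_C,
      Polynomial.derivative_X, Polynomial.derivative_add, Polynomial.derivative_zero] at h2
    simp only [map_mul, map_sub, map_add, map_ofNat, map_one, map_natCast, Nat.cast_add,
      Nat.cast_one] at h2 ⊢
    push_cast at h2
    linear_combination h2

lemma coeff_X_sq_sub_one_pow (ℓ s : ℕ) :
    ((Polynomial.X ^ 2 - 1) ^ ℓ : ℝ[X]).coeff s =
      if 2 ∣ s then (-1) ^ (ℓ - s / 2) * (ℓ.choose (s / 2) : ℝ) else 0 := by
  have h : ((Polynomial.X ^ 2 - 1) ^ ℓ : ℝ[X]) =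
      Polynomial.expand ℝ 2 ((Polynomial.X + Polynomial.C (-1)) ^ ℓ) := by
    simp [sub_eq_add_neg]
  rw [h, Polynomial.coeff_expand two_pos]
  simp only [Polynomial.coeff_X_add_C_pow]

lemma eval_zero_rodrigues (ℓ s : ℕ) : (rodrigues ℓ s).eval 0 =
    if 2 ∣ s then (s.factorial : ℝ) * ((-1) ^ (ℓ - s / 2) * (ℓ.choose (s / 2) : ℝ)) else 0 := by
  rw [← Polynomial.coeff_zero_eq_eval_zero, rodrigues, Polynomial.coeff_iterate_derivative,
    zero_add, coeff_X_sq_sub_one_pow, Nat.descFactorial_self, nsmul_eq_mul]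
  split_ifs <;> simp

lemma rodrigues_two_mul (ℓ : ℕ) : rodrigues ℓ (ℓ + ℓ) = Polynomial.C ((2 * ℓ).factorial : ℝ) := by
  have hdeg : (rodrigues ℓ (ℓ + ℓ)).natDegree = 0 := by
    have h1 := Polynomial.natDegree_iterate_derivative ((Polynomial.X ^ 2 - 1) ^ ℓ : ℝ[X]) (ℓ + ℓ)
    have h2 : ((Polynomial.X ^ 2 - 1) ^ ℓ : ℝ[X]).natDegree ≤ ℓ * 2 := by
      refine Polynomial.natDegree_pow_le_of_le ℓ ?_
      rw [← Polynomial.C_1, Polynomial.natDegree_X_pow_sub_C]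
    unfold rodrigues
    omega
  rw [Polynomial.eq_C_of_natDegree_eq_zero hdeg, Polynomial.coeff_zero_eq_eval_zero,
    eval_zero_rodrigues, if_pos (by omega), show ℓ + ℓ = 2 * ℓ by ring]
  simp

lemma integral_eval_derivative (p : ℝ[X]) (a b : ℝ) :
    ∫ x in a..b, (Polynomial.derivative p).eval x = p.eval b - p.eval a :=
  intervalIntegral.integral_eq_sub_of_hasDerivAt (fun x _ => p.hasDerivAt x)
    ((Polynomial.derivative p).continuous.intervalIntegrable _ _)

/-- `∫_0^1 (1-x²)^k ((d/dx)^{ℓ+k} (x²-1)^ℓ)² dx`. -/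
noncomputable def rodriguesNorm (ℓ k : ℕ) : ℝ :=
  ∫ x in (0 : ℝ)..1, (1 - x ^ 2) ^ k * (rodrigues ℓ (ℓ + k)).eval x ^ 2

/-- By the differential equation, the derivative of `(1-x²)^{k+1} R_{ℓ+k+1} R_{ℓ+k}`, with `R_s =
rodrigues ℓ s`, is the difference of the two integrands. Its integral vanishes because the product
is zero at both endpoints. -/
lemma rodriguesNorm_succ (ℓ k : ℕ) :
    rodriguesNorm ℓ (k + 1) = ((ℓ : ℝ) - k) * (ℓ + k + 1) * rodriguesNorm ℓ k := by
  set p : ℝ[X] := (1 - Polynomial.X ^ 2) ^ (k + 1) * rodrigues ℓ (ℓ + k + 1) * rodrigues ℓ (ℓ + k)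
    with hp
  -- Of two consecutive derivatives of an even polynomial one is odd, so the half interval produces
  -- no boundary term at `0`.
  have h0 : p.eval 0 = 0 := by
    have : (rodrigues ℓ (ℓ + k + 1)).eval 0 = 0 ∨ (rodrigues ℓ (ℓ + k)).eval 0 = 0 := by
      rw [eval_zero_rodrigues, eval_zero_rodrigues]
      by_cases h : 2 ∣ ℓ + k
      · left; rw [if_neg (by omega)]
      · right; rw [if_neg h]
    rcases this with h | h <;> simp [hp, h]
  have h1 : p.eval 1 = 0 := by simp [hp]
  have hd : Polynomial.derivative p =
      (1 - Polynomial.X ^ 2) ^ (k + 1) * rodrigues ℓ (ℓ + (k + 1)) ^ 2 -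
      Polynomial.C (((ℓ : ℝ) - k) * (ℓ + k + 1)) *
        ((1 - Polynomial.X ^ 2) ^ k * rodrigues ℓ (ℓ + k) ^ 2) := by
    have ho := rodrigues_ode ℓ (ℓ + k)
    rw [hp, Polynomial.derivative_mul, Polynomial.derivative_mul, derivative_rodrigues,
      derivative_rodrigues, Polynomial.derivative_pow]
    simp only [Polynomial.derivative_sub, Polynomial.derivative_X_pow, Polynomial.derivative_one,
      Nat.add_sub_cancel, ← add_assoc]
    simp only [map_mul, map_sub, map_add, map_ofNat, map_one, map_natCast, Nat.cast_add,
      Nat.cast_one] at ho ⊢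
    rw [show ℓ + k + 1 + 1 = ℓ + k + 2 by ring, pow_succ (1 - Polynomial.X ^ 2 : ℝ[X]) k]
    push_cast
    linear_combination (1 - Polynomial.X ^ 2 : ℝ[X]) ^ k * rodrigues ℓ (ℓ + k) * ho
  have hi := integral_eval_derivative p 0 1
  rw [h0, h1, hd] at hi
  simp only [Polynomial.eval_sub, Polynomial.eval_mul, Polynomial.eval_pow, Polynomial.eval_C,
    Polynomial.eval_one, Polynomial.eval_X] at hi
  rw [intervalIntegral.integral_sub (by apply Continuous.intervalIntegrable; fun_prop)
    (by apply Continuous.intervalIntegrable; fun_prop), intervalIntegral.integral_const_mul] at hi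
  unfold rodriguesNorm
  linarith

lemma factorial_mul_rodriguesNorm {ℓ k : ℕ} (hk : k ≤ ℓ) :
    ((ℓ - k).factorial : ℝ) * rodriguesNorm ℓ k = (ℓ + k).factorial * rodriguesNorm ℓ 0 := by
  induction k with
  | zero => simp
  | succ k ih =>
    have h1 := ih (by omega)
    have h2 : ((ℓ - k).factorial : ℝ) = ((ℓ : ℝ) - k) * (ℓ - (k + 1)).factorial := by
      rw [show ℓ - k = (ℓ - (k + 1)) + 1 by omega, Nat.factorial_succ]
      push_cast [Nat.cast_sub hk]
      ring
    rw [h2] at h1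
    rw [rodriguesNorm_succ, ← add_assoc, Nat.factorial_succ]
    push_cast
    linear_combination ((ℓ : ℝ) + k + 1) * h1

/-- Integrating the derivative of `x (1-x²)^{ℓ+1}` gives `(2ℓ+3) I_{ℓ+1} = (2ℓ+2) I_ℓ`. -/
lemma integral_one_sub_sq_pow (ℓ : ℕ) :
    ∫ x in (0 : ℝ)..1, (1 - x ^ 2) ^ ℓ = 4 ^ ℓ * (ℓ.factorial : ℝ) ^ 2 / (2 * ℓ + 1).factorial := by
  induction ℓ with
  | zero => simp
  | succ ℓ ih =>
    set p : ℝ[X] := Polynomial.X * (1 - Polynomial.X ^ 2) ^ (ℓ + 1) with hp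
    have hd : Polynomial.derivative p =
        Polynomial.C (2 * (ℓ : ℝ) + 3) * (1 - Polynomial.X ^ 2) ^ (ℓ + 1) -
        Polynomial.C (2 * ((ℓ : ℝ) + 1)) * (1 - Polynomial.X ^ 2) ^ ℓ := by
      rw [hp, Polynomial.derivative_mul, Polynomial.derivative_pow]
      simp only [Polynomial.derivative_sub, Polynomial.derivative_X_pow, Polynomial.derivative_one,
        Nat.add_sub_cancel, Polynomial.derivative_X, map_mul, map_add, map_ofNat, map_one,
        map_natCast]
      push_cast
      ring
    have hi := integral_eval_derivative p 0 1
    rw [hd] at hi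
    simp only [Polynomial.eval_sub, Polynomial.eval_mul, Polynomial.eval_pow, Polynomial.eval_C,
      Polynomial.eval_one, Polynomial.eval_X, hp] at hi
    rw [intervalIntegral.integral_sub (by apply Continuous.intervalIntegrable; fun_prop)
      (by apply Continuous.intervalIntegrable; fun_prop), intervalIntegral.integral_const_mul,
      intervalIntegral.integral_const_mul, ih] at hi
    have h3 : (2 * (ℓ : ℝ) + 3) ≠ 0 := by positivity
    apply mul_left_cancel₀ h3
    rw [show 2 * (ℓ + 1) + 1 = 2 * ℓ + 1 + 1 + 1 by ring, Nat.factorial_succ, Nat.factorial_succ,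
      Nat.factorial_succ]
    norm_num at hi
    rw [sub_eq_zero] at hi
    rw [hi]
    push_cast
    field_simp
    ring

/-- The recursion in `k` is anchored at `k = ℓ`, where the derivative of order `2ℓ` is the constant
`(2ℓ)!` and the integral is explicit. -/
lemma rodriguesNorm_eq {ℓ k : ℕ} (hk : k ≤ ℓ) : rodriguesNorm ℓ k =
    (ℓ + k).factorial / (ℓ - k).factorial * (4 ^ ℓ * (ℓ.factorial : ℝ) ^ 2 / (2 * ℓ + 1)) := by
  have h1 := factorial_mul_rodriguesNorm (le_refl ℓ)
  have h2 : rodriguesNorm ℓ ℓ = ((2 * ℓ).factorial : ℝ) ^ 2 *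
      (4 ^ ℓ * (ℓ.factorial : ℝ) ^ 2 / (2 * ℓ + 1).factorial) := by
    rw [rodriguesNorm, rodrigues_two_mul, ← integral_one_sub_sq_pow]
    simp only [Polynomial.eval_C, intervalIntegral.integral_mul_const]
    ring
  rw [h2, Nat.sub_self, Nat.factorial_zero, ← two_mul, Nat.factorial_succ] at h1
  push_cast at h1
  have h3 : rodriguesNorm ℓ 0 = 4 ^ ℓ * (ℓ.factorial : ℝ) ^ 2 / (2 * ℓ + 1) := by
    have : ((2 * ℓ).factorial : ℝ) ≠ 0 := by positivity
    apply mul_left_cancel₀ this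
    rw [← h1]
    field_simp
  have h4 := factorial_mul_rodriguesNorm hk
  rw [h3] at h4
  field_simp at h4 ⊢
  linarith

/-- The normalised polar factor of `Y_ℓ^m` as a function of `x = cos θ`. -/
noncomputable def radial (ℓ : ℕ) (m : ℤ) (x : ℝ) : ℝ :=
  √((2 * ℓ + 1) / (2 * π) * (((ℓ - m).toNat.factorial : ℝ) / ((ℓ + m).toNat.factorial : ℝ))) *
    assocLegendre ℓ m x

lemma sphHarm_eq (ℓ : ℕ) (m : ℤ) (θ φ : ℝ) :
    sphHarm ℓ m θ φ = (radial ℓ m (Real.cos θ) : ℝ) * Complex.exp (Complex.I * m * φ) := by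
  rw [sphHarm, radial, Complex.ofReal_mul]

lemma continuous_radial (ℓ : ℕ) (m : ℤ) : Continuous (radial ℓ m) :=
  continuous_const.mul (continuous_assocLegendre ℓ m)

lemma assocLegendreNat_sq (ℓ k : ℕ) {x : ℝ} (hx : x ^ 2 ≤ 1) : assocLegendreNat ℓ k x ^ 2 =
    (1 - x ^ 2) ^ k * (rodrigues ℓ (ℓ + k)).eval x ^ 2 / (4 ^ ℓ * (ℓ.factorial : ℝ) ^ 2) := by
  rw [assocLegendreNat, ← rodrigues, mul_pow, mul_pow, div_pow, ← pow_mul, mul_comm k 2, pow_mul,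
    ← pow_mul √(1 - x ^ 2), mul_comm k 2, pow_mul √(1 - x ^ 2), Real.sq_sqrt (by linarith), mul_pow,
    ← pow_mul 2 ℓ, mul_comm ℓ 2, pow_mul 2 2]
  norm_num
  ring

/-- The convention for negative `m` inverts the factorial ratio, so the square depends on `|m|`
only. -/
lemma radial_sq {ℓ : ℕ} {m : ℤ} (hm : m.natAbs ≤ ℓ) (x : ℝ) : radial ℓ m x ^ 2 =
    (2 * ℓ + 1) / (2 * π) * (((ℓ - m.natAbs).factorial : ℝ) / ((ℓ + m.natAbs).factorial : ℝ)) *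
      assocLegendreNat ℓ m.natAbs x ^ 2 := by
  rw [radial, mul_pow, Real.sq_sqrt (by positivity), assocLegendre]
  set k := m.natAbs with hk
  split_ifs with h
  · rw [show ((ℓ : ℤ) - m).toNat = ℓ - k by omega, show ((ℓ : ℤ) + m).toNat = ℓ + k by omega]
  · rw [show ((ℓ : ℤ) - m).toNat = ℓ + k by omega, show ((ℓ : ℤ) + m).toNat = ℓ - k by omega]
    rw [mul_pow, div_pow, mul_pow, ← pow_mul, mul_comm k 2, pow_mul]
    field_simp
    norm_num

lemma integral_radial_sq {ℓ : ℕ} {m : ℤ} (hm : m.natAbs ≤ ℓ) :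
    ∫ x in (0 : ℝ)..1, radial ℓ m x ^ 2 = 1 / (2 * π) := by
  have h : ∀ x ∈ uIcc (0 : ℝ) 1, radial ℓ m x ^ 2 =
      (2 * ℓ + 1) / (2 * π) * (((ℓ - m.natAbs).factorial : ℝ) / ((ℓ + m.natAbs).factorial : ℝ)) *
      (((1 - x ^ 2) ^ m.natAbs * (rodrigues ℓ (ℓ + m.natAbs)).eval x ^ 2) *
        (1 / (4 ^ ℓ * (ℓ.factorial : ℝ) ^ 2))) := by
    intro x hx
    rw [uIcc_of_le zero_le_one] at hx
    rw [radial_sq hm, assocLegendreNat_sq ℓ _ (by nlinarith [hx.1, hx.2]), mul_one_div]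
  rw [intervalIntegral.integral_congr h, intervalIntegral.integral_const_mul,
    intervalIntegral.integral_mul_const]
  have := rodriguesNorm_eq hm
  rw [rodriguesNorm] at this
  rw [this]
  field_simp

lemma integral_radial_sq_cos {ℓ : ℕ} {m : ℤ} (hm : m.natAbs ≤ ℓ) :
    ∫ θ in (0 : ℝ)..(π / 2), radial ℓ m (Real.cos θ) ^ 2 * Real.sin θ = 1 / (2 * π) := by
  have h := intervalIntegral.integral_comp_mul_deriv (a := (0 : ℝ)) (b := π / 2) (f := Real.cos)
    (f' := fun θ => -Real.sin θ) (g := fun x => radial ℓ m x ^ 2)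
    (fun θ _ => Real.hasDerivAt_cos θ) (by fun_prop)
    ((continuous_radial ℓ m).pow 2)
  simp only [Function.comp_apply, mul_neg, intervalIntegral.integral_neg, Real.cos_zero,
    Real.cos_pi_div_two] at h
  rw [intervalIntegral.integral_symm (0 : ℝ) 1, integral_radial_sq hm] at h
  linarith

/-- When `ℓ + |m| = 2b`, the Rodrigues derivative at `0` is `± (2b)! (ℓ choose b)`. The
normalisation turns its square into a product of two central binomials, symmetric under `j ↔ ℓ - j`.
-/
lemma radial_zero_sq {ℓ j : ℕ} (hj : j ≤ ℓ) :
    2 * π * radial ℓ (2 * j - ℓ) 0 ^ 2 = weight (ℓ + 1) j ^ 2 := by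
  have hcr : ∀ a : ℕ, centralRatio a = (2 * a).factorial / (4 ^ a * (a.factorial : ℝ) ^ 2) := by
    intro a
    have h := Nat.choose_mul_factorial_mul_factorial (show a ≤ 2 * a by omega)
    rw [show 2 * a - a = a by omega] at h
    have h' : (((2 * a).choose a : ℕ) : ℝ) * a.factorial * a.factorial = (2 * a).factorial := by
      exact_mod_cast h
    rw [centralRatio, Nat.centralBinom_eq_two_mul_choose, ← h']
    field_simp
  have hval : ∀ k b : ℕ, b ≤ ℓ → ℓ + k = 2 * b → assocLegendreNat ℓ k 0 ^ 2 =
      ((2 * b).factorial : ℝ) ^ 2 / (4 ^ ℓ * (b.factorial * (ℓ - b).factorial : ℝ) ^ 2) := by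
    intro k b hb hkb
    rw [assocLegendreNat_sq ℓ k (by norm_num), hkb, eval_zero_rodrigues, if_pos (by omega),
      show 2 * b / 2 = b by omega]
    have h := Nat.choose_mul_factorial_mul_factorial hb
    have h' : ((ℓ.choose b : ℕ) : ℝ) * b.factorial * (ℓ - b).factorial = ℓ.factorial := by
      exact_mod_cast h
    rw [← h']
    have hc : ((ℓ.choose b : ℕ) : ℝ) ≠ 0 := by
      exact_mod_cast (Nat.choose_pos hb).ne'
    rw [mul_pow, mul_pow ((-1 : ℝ) ^ (ℓ - b)), ← pow_mul, mul_comm (ℓ - b) 2, pow_mul]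
    norm_num
    field_simp
  have h4 : (4 : ℝ) ^ ℓ = 4 ^ j * 4 ^ (ℓ - j) := by rw [← pow_add]; congr 1; omega
  rw [weight_sq (by omega), radial_sq (by omega), hcr, hcr, show ℓ + 1 - 1 - j = ℓ - j by omega]
  -- The sign of `m = 2j - ℓ` decides whether `b = j` or `b = ℓ - j`.
  rcases le_total ℓ (2 * j) with h | h
  · rw [hval _ j hj (by omega), show ℓ + (2 * (j : ℤ) - ℓ).natAbs = 2 * j by omega,
      show ℓ - (2 * (j : ℤ) - ℓ).natAbs = 2 * (ℓ - j) by omega, h4]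
    push_cast
    field_simp
    ring
  · rw [hval _ (ℓ - j) (by omega) (by omega),
      show ℓ + (2 * (j : ℤ) - ℓ).natAbs = 2 * (ℓ - j) by omega,
      show ℓ - (2 * (j : ℤ) - ℓ).natAbs = 2 * j by omega, h4, show ℓ - (ℓ - j) = j by omega]
    push_cast
    field_simp
    ring

/-! ### From the operator to its matrix -/

lemma trFun_eq_sum_eigenvalues {E : Type*} [NormedAddCommGroup E] [InnerProductSpace ℂ E]
    [CompleteSpace E] {n : ℕ} {T : E →L[ℂ] E} (hT : IsSelfAdjoint T)
    (e : OrthonormalBasis (Fin n) ℂ E) {A : Matrix (Fin n) (Fin n) ℂ} (hA : A.IsHermitian)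
    (hTA : ∀ i j, ⟪T (e i), e j⟫_ℂ = A i j) (f : ℝ → ℝ) :
    trFun f T = ((∑ i, f (hA.eigenvalues i) : ℝ) : ℂ) := by
  refine trFun_eq_sum hT (hA.eigenvectorBasis.map e.repr.symm) (fun i => ?_) f
  rw [OrthonormalBasis.map_apply]
  set b := hA.eigenvectorBasis i with hb
  refine e.repr.injective (PiLp.ext fun k => ?_)
  -- Self-adjointness gives `⟪e k, T x⟫ = ⟪T (e k), x⟫`, so `A` acts on the coordinates of `x` and
  -- carries eigenvectors of `A` to eigenvectors of `T`.
  rw [e.repr_apply_apply, e.repr_apply_apply, ← ContinuousLinearMap.adjoint_inner_left, hT.adjoint_eq,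
    inner_smul_right, ← e.repr_apply_apply, LinearIsometryEquiv.apply_symm_apply,
    ← e.sum_repr_symm b, inner_sum]
  simp only [inner_smul_right, hTA]
  have := congrFun (hA.mulVec_eigenvectorBasis i) k
  rw [← hb] at this
  simp only [Matrix.mulVec, dotProduct, Pi.smul_apply] at this
  simp_rw [mul_comm _ (A k _)]
  exact this

lemma integral_polarMeasure (F : ℝ → ℂ) :
    ∫ θ : Polar, F θ ∂polarMeasure = ∫ θ in (0 : ℝ)..(π / 2), Real.sin θ * F θ := by
  have hm : Measurable fun θ : Polar => (Real.sin (θ : ℝ)).toNNReal := by fun_prop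
  have h1 : polarMeasure = (Measure.comap Subtype.val volume : Measure Polar).withDensity
      (fun θ => ((Real.sin (θ : ℝ)).toNNReal : ENNReal)) := rfl
  rw [h1, integral_withDensity_eq_integral_smul hm,
    intervalIntegral.integral_of_le (by positivity), ← integral_Icc_eq_integral_Ioc,
    ← integral_subtype_comap measurableSet_Icc fun θ : ℝ => (Real.sin θ : ℂ) * F θ]
  refine integral_congr_ae (ae_of_all _ fun θ => ?_)
  have h2 : 0 ≤ Real.sin θ := Real.sin_nonneg_of_nonneg_of_le_pi θ.2.1 (by
    have := θ.2.2; linarith [Real.pi_pos])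
  simp only [NNReal.smul_def, Real.coe_toNNReal _ h2, Complex.real_smul]

lemma integral_azimuthMeasure (F : ℝ → ℂ) :
    ∫ φ : Azimuth, F φ ∂azimuthMeasure = ∫ φ in (-π)..π, F φ := by
  rw [intervalIntegral.integral_of_le (by linarith [Real.pi_pos]), ← integral_Icc_eq_integral_Ioc,
    ← integral_subtype_comap measurableSet_Icc F]
  rfl

lemma inner_sphHarmC (ℓ : ℕ) (m k : ℤ) :
    ⟪toL2 (sphHarmC ℓ m), toL2 (sphHarmC ℓ k)⟫_ℂ =
      (∫ θ in (0 : ℝ)..(π / 2), Real.sin θ * (radial ℓ k (Real.cos θ) * radial ℓ m (Real.cos θ)) : ℝ) *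
      ∫ φ in (-π)..π, Complex.exp (Complex.I * (k - m : ℤ) * φ) := by
  rw [inner_toL2, hemiMeasure, ← integral_azimuthMeasure, ← intervalIntegral.integral_ofReal]
  simp only [Complex.ofReal_mul (Real.sin _)]
  rw [← integral_polarMeasure fun θ =>
    ((radial ℓ k (Real.cos θ) * radial ℓ m (Real.cos θ) : ℝ) : ℂ), ← integral_prod_mul]
  refine integral_congr_ae (ae_of_all _ fun p => ?_)
  simp only [sphHarmC, ContinuousMap.coe_mk, sphHarm_eq, map_mul, Complex.conj_ofReal,
    ← Complex.exp_conj, Complex.conj_I, map_intCast]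
  have : Complex.exp (Complex.I * (k - m : ℤ) * (p.2 : ℝ)) =
      Complex.exp (Complex.I * k * (p.2 : ℝ)) * Complex.exp (-Complex.I * m * (p.2 : ℝ)) := by
    rw [← Complex.exp_add]; congr 1; push_cast; ring
  rw [this]
  push_cast
  ring

/-! ### The orthonormal basis of the Neumann eigenspace -/

section Basis

variable {ℓ : ℕ}

lemma mem_neumannIndices (j : Fin (ℓ + 1)) : (2 * (j : ℤ) - ℓ) ∈ neumannIndices ℓ :=
  ⟨by omega, by omega, ⟨j - ℓ, by ring⟩⟩

/-- Distinct indices are orthogonal through the azimuthal integral alone; on the diagonal the polar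
factor `1/(2π)` cancels the length `2π`. -/
lemma inner_neumann (i j : Fin (ℓ + 1)) :
    ⟪toL2 (sphHarmC ℓ (2 * i - ℓ)), toL2 (sphHarmC ℓ (2 * j - ℓ))⟫_ℂ = if i = j then 1 else 0 := by
  have hpi : (π : ℂ) ≠ 0 := by exact_mod_cast Real.pi_ne_zero
  have h1 := integral_exp_two_I ((j : ℤ) - i)
  have h2 : ∀ φ : ℝ, Complex.exp (2 * Complex.I * ((j : ℤ) - i : ℤ) * φ) =
      Complex.exp (Complex.I * (2 * (j : ℤ) - ℓ - (2 * (i : ℤ) - ℓ) : ℤ) * φ) := fun φ => by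
    congr 1; push_cast; ring
  simp_rw [h2] at h1
  rw [inner_sphHarmC]
  split_ifs with h
  · subst h
    rw [if_pos (sub_self _)] at h1
    have h3 := integral_radial_sq_cos (ℓ := ℓ) (m := 2 * (i : ℤ) - ℓ) (by omega)
    have h4 : ∫ θ in (0 : ℝ)..(π / 2), Real.sin θ *
        (radial ℓ (2 * i - ℓ) (Real.cos θ) * radial ℓ (2 * i - ℓ) (Real.cos θ)) =
        1 / (2 * π) := by
      rw [← h3]; congr 1; ext θ; ring
    rw [h4, ← h1]
    push_cast
    ring
  · rw [if_neg (by omega)] at h1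
    rcases mul_eq_zero.1 h1 with h3 | h3
    · simp [hpi] at h3
    · rw [h3, mul_zero]

/-- The sign making the basis function nonnegative at `φ = 0` on the equator. -/
noncomputable def equatorSign (ℓ : ℕ) (m : ℤ) : ℝ := if 0 ≤ radial ℓ m 0 then 1 else -1

lemma equatorSign_mul_self (ℓ : ℕ) (m : ℤ) : equatorSign ℓ m * equatorSign ℓ m = 1 := by
  unfold equatorSign; split_ifs <;> norm_num

lemma equatorSign_mul_radial (ℓ : ℕ) (m : ℤ) :
    equatorSign ℓ m * radial ℓ m 0 = |radial ℓ m 0| := by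
  unfold equatorSign
  split_ifs with h
  · rw [abs_of_nonneg h, one_mul]
  · rw [abs_of_neg (not_le.1 h), neg_one_mul]

lemma smul_sphHarmC_mem (c : ℂ) (j : Fin (ℓ + 1)) :
    c • sphHarmC ℓ (2 * j - ℓ) ∈ neumannFun ℓ :=
  Submodule.smul_mem _ _ (Submodule.subset_span ⟨_, mem_neumannIndices j, rfl⟩)

/-- The normalised spherical harmonics `± Y_ℓ^{2j-ℓ}`. -/
noncomputable def neumannVec (ℓ : ℕ) (j : Fin (ℓ + 1)) : ranP ℓ :=
  ⟨toL2 ((equatorSign ℓ (2 * j - ℓ) : ℂ) • sphHarmC ℓ (2 * j - ℓ)),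
    Submodule.mem_map_of_mem (smul_sphHarmC_mem _ j)⟩

lemma orthonormal_neumannVec : Orthonormal ℂ (neumannVec ℓ) := by
  rw [orthonormal_iff_ite]
  intro i j
  rw [Submodule.coe_inner]
  simp only [neumannVec, map_smul, inner_smul_left, inner_smul_right, inner_neumann,
    Complex.conj_ofReal]
  split_ifs with h
  · subst h
    rw [mul_one]
    exact_mod_cast equatorSign_mul_self _ _
  · simp

lemma span_neumannVec : ⊤ ≤ Submodule.span ℂ (range (neumannVec ℓ)) := by
  have h : ranP ℓ ≤ (Submodule.span ℂ (range (neumannVec ℓ))).map (ranP ℓ).subtype := by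
    change (neumannFun ℓ).map toL2 ≤ _
    rw [neumannFun, Submodule.map_span, Submodule.span_le]
    rintro _ ⟨_, ⟨m, ⟨hm1, hm2, k, hk⟩, rfl⟩, rfl⟩
    -- Evenness is `m - ℓ = k + k`, so the index is `j = k + ℓ`.
    have hj : m = 2 * ((⟨(k + ℓ).toNat, by omega⟩ : Fin (ℓ + 1)) : ℕ) - ℓ := by
      simp only; omega
    set j : Fin (ℓ + 1) := ⟨(k + ℓ).toNat, by omega⟩ with hjd
    refine ⟨(equatorSign ℓ m : ℂ) • neumannVec ℓ j,
      Submodule.smul_mem _ _ (Submodule.subset_span ⟨j, rfl⟩), ?_⟩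
    rw [map_smul, Submodule.subtype_apply, neumannVec]
    simp only [← hj]
    simp only [map_smul, smul_smul, ← Complex.ofReal_mul, equatorSign_mul_self, Complex.ofReal_one,
      one_smul]
  intro u _
  obtain ⟨v, hv, hvu⟩ := h u.2
  rwa [← Subtype.ext hvu]

/-- The orthonormal basis `± Y_ℓ^{2j-ℓ}` of the Neumann eigenspace. -/
noncomputable def neumannBasis (ℓ : ℕ) : OrthonormalBasis (Fin (ℓ + 1)) ℂ (ranP ℓ) :=
  OrthonormalBasis.mk orthonormal_neumannVec span_neumannVec

lemma contRep_mk {g : C(Hemi, ℂ)} (hg : g ∈ neumannFun ℓ) :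
    contRep ℓ ⟨toL2 g, Submodule.mem_map_of_mem hg⟩ = ⟨g, hg⟩ := by
  rw [contRep, LinearEquiv.symm_apply_eq]
  ext1
  rfl

lemma equator_neumannBasis (j : Fin (ℓ + 1)) (φ : Azimuth) :
    equator (neumannBasis ℓ j) φ = ((weight (ℓ + 1) j / √(2 * π) : ℝ) : ℂ) *
      Complex.exp (Complex.I * (2 * j - ℓ) * (φ : ℝ)) := by
  have h1 : |radial ℓ (2 * j - ℓ) 0| = weight (ℓ + 1) j / √(2 * π) := by
    rw [eq_div_iff (by positivity)]
    refine (sq_eq_sq₀ (by positivity)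
      (show 0 ≤ weight (ℓ + 1) j from Real.sqrt_nonneg _)).1 ?_
    rw [← radial_zero_sq (by omega : (j : ℕ) ≤ ℓ), mul_pow, sq_abs, Real.sq_sqrt (by positivity)]
    ring
  rw [equator, neumannBasis, OrthonormalBasis.coe_mk, neumannVec, contRep_mk (smul_sphHarmC_mem _ j), ← h1,
    ← equatorSign_mul_radial]
  simp only [ContinuousMap.smul_apply, sphHarmC, ContinuousMap.coe_mk, sphHarm_eq,
    Real.cos_pi_div_two, smul_eq_mul]
  push_cast
  ring

/-- The offset `ℓ` cancels in the product of the two exponentials, leaving `e^{2i(j-i)φ}`. -/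
lemma inner_V_neumannBasis {σ : ℝ → ℝ} (hσ : Continuous σ) (i j : Fin (ℓ + 1)) :
    ⟪V ℓ hσ (neumannBasis ℓ i), neumannBasis ℓ j⟫_ℂ =
      toepMat (fun j : Fin (ℓ + 1) => weight (ℓ + 1) j) σ i j := by
  rw [inner_V, toepMat]
  have h : ∀ φ : Azimuth, (σ φ : ℂ) * (conj (equator (neumannBasis ℓ i) φ) *
      equator (neumannBasis ℓ j) φ) = ((weight (ℓ + 1) i * weight (ℓ + 1) j * (1 / (2 * π)) : ℝ) : ℂ) *
        (fun φ : ℝ => (σ φ : ℂ) * Complex.exp (2 * Complex.I * (j - i) * φ)) φ := by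
    intro φ
    have h1 : Complex.exp (2 * Complex.I * (j - i) * (φ : ℝ)) =
        Complex.exp (-Complex.I * (2 * i - ℓ) * (φ : ℝ)) *
          Complex.exp (Complex.I * (2 * j - ℓ) * (φ : ℝ)) := by
      rw [← Complex.exp_add]; congr 1; ring
    have h2 : (1 / (2 * π) : ℝ) = 1 / √(2 * π) * (1 / √(2 * π)) := by
      rw [one_div_mul_one_div, Real.mul_self_sqrt (by positivity)]
    rw [equator_neumannBasis, equator_neumannBasis]
    simp only [map_mul, Complex.conj_ofReal, ← Complex.exp_conj, map_sub, Complex.conj_I,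
      map_natCast, Complex.conj_ofNat, h1, h2]
    push_cast
    ring
  simp_rw [h]
  rw [integral_const_mul, integral_azimuthMeasure
    fun φ : ℝ => (σ φ : ℂ) * Complex.exp (2 * Complex.I * (j - i) * φ)]
  push_cast
  ring

end Basis

/-! ### Even part, change of variables, and the limit for convex functions -/

lemma continuous_evenPart {σ : ℝ → ℝ} (hσ : Continuous σ) : Continuous (evenPart σ) := by
  unfold evenPart; fun_prop

lemma periodic_evenPart {σ : ℝ → ℝ} (hper : Function.Periodic σ (2 * π)) :
    Function.Periodic (evenPart σ) π := by
  intro φ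
  have := hper φ
  rw [evenPart, evenPart, show φ + π + π = φ + 2 * π by ring, this, add_comm]

/-- Only the even part of `σ` enters the weighted Toeplitz matrix. -/
lemma toepMat_evenPart {σ : ℝ → ℝ} (hσ : Continuous σ) (hper : Function.Periodic σ (2 * π))
    {n : ℕ} (s : Fin n → ℝ) : toepMat s (evenPart σ) = toepMat s σ := by
  ext i j
  rw [toepMat, toepMat]
  congr 2
  set F : ℝ → ℂ := fun φ => σ φ * Complex.exp (2 * Complex.I * (j - i) * φ) with hF
  have hcont : Continuous F := by rw [hF]; fun_prop
  have hexp : ∀ φ : ℝ, ∀ k : ℤ, Complex.exp (2 * Complex.I * (j - i) * ((φ + k * π : ℝ) : ℂ)) =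
      Complex.exp (2 * Complex.I * (j - i) * φ) := by
    intro φ k
    rw [Complex.exp_eq_exp_iff_exists_int]
    exact ⟨((j : ℤ) - i) * k, by push_cast; ring⟩
  have hFper : Function.Periodic F (2 * π) := by
    intro φ
    have := hexp φ 2
    simp only [hF, hper φ]
    push_cast at this ⊢
    rw [this]
  have h1 : ∀ φ : ℝ, (evenPart σ φ : ℂ) * Complex.exp (2 * Complex.I * (j - i) * φ) =
      1 / 2 * (F φ + F (φ + π)) := by
    intro φ
    have := hexp φ 1
    simp only [hF, evenPart]
    push_cast at this ⊢
    rw [one_mul] at this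
    rw [this]
    ring
  have h2 : ∫ φ in (-π)..π, F (φ + π) = ∫ φ in (-π)..π, F φ := by
    rw [intervalIntegral.integral_comp_add_right]
    have := hFper.intervalIntegral_add_eq (-π + π) (-π)
    rw [show -π + π + 2 * π = π + π by ring, show -π + 2 * π = π by ring] at this
    exact this
  simp_rw [h1]
  rw [intervalIntegral.integral_const_mul, intervalIntegral.integral_add
    (hcont.intervalIntegrable _ _) (by apply Continuous.intervalIntegrable; fun_prop), h2]
  ring

lemma trFun_V {σ : ℝ → ℝ} (hσ : Continuous σ) (hper : Function.Periodic σ (2 * π)) (ℓ : ℕ)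
    (f : ℝ → ℝ) : trFun f (V ℓ hσ) = ((∑ i, f ((isHermitian_toepMat
      (fun j : Fin (ℓ + 1) => weight (ℓ + 1) j) (evenPart σ)).eigenvalues i) : ℝ) : ℂ) := by
  refine trFun_eq_sum_eigenvalues (isSelfAdjoint_V hσ) (neumannBasis ℓ) _ (fun i j => ?_) f
  rw [toepMat_evenPart hσ hper, inner_V_neumannBasis]

/-- Substitute `ξ = 2t - 1`: then `√(1-ξ²) = 2√(t(1-t))`, and `dξ = 2 dt` turns `1/(4π)` into
`1/(2π)`. -/
lemma limitValue_eq_symbolMean (f σ : ℝ → ℝ) :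
    limitValue f σ = symbolMean f profile (evenPart σ) := by
  have h : ∀ y : ℝ, ∫ ξ in (-1 : ℝ)..1, f (4 * y / (π * √(1 - ξ ^ 2))) =
      2 * ∫ t in (0 : ℝ)..1, f (profile t * y) := by
    intro y
    have h1 := intervalIntegral.integral_comp_mul_sub (a := (0 : ℝ)) (b := 1)
      (fun ξ => f (4 * y / (π * √(1 - ξ ^ 2)))) (c := 2) two_ne_zero 1
    have h2 : ∀ t : ℝ, 4 * y / (π * √(1 - (2 * t - 1) ^ 2)) = profile t * y := by
      intro t
      rw [show 1 - (2 * t - 1) ^ 2 = 2 ^ 2 * (t * (1 - t)) by ring, Real.sqrt_mul (by positivity),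
        Real.sqrt_sq zero_le_two, profile]
      ring
    simp only [h2] at h1
    rw [h1, smul_eq_mul, mul_inv_cancel_left₀ two_ne_zero]
    norm_num
  simp only [limitValue, h, symbolMean, intervalIntegral.integral_const_mul]
  ring

lemma symbolMean_sub_of_lipschitz {f₁ f₂ g w : ℝ → ℝ} {L₁ L₂ : ℝ}
    (h₁ : ∀ x y, |f₁ x - f₁ y| ≤ L₁ * |x - y|) (h₂ : ∀ x y, |f₂ x - f₂ y| ≤ L₂ * |x - y|)
    (hw : IntervalIntegrable w volume 0 1) (hg : Continuous g) :
    symbolMean (fun x => f₁ x - f₂ x) w g = symbolMean f₁ w g - symbolMean f₂ w g := by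
  have hc₁ : Continuous fun φ => ∫ t in (0 : ℝ)..1, f₁ (w t * g φ) :=
    (continuous_integral_comp h₁ hw).comp hg
  have hc₂ : Continuous fun φ => ∫ t in (0 : ℝ)..1, f₂ (w t * g φ) :=
    (continuous_integral_comp h₂ hw).comp hg
  simp only [symbolMean]
  rw [← mul_sub, ← intervalIntegral.integral_sub (hc₁.intervalIntegrable _ _)
    (hc₂.intervalIntegrable _ _)]
  simp only [intervalIntegral.integral_sub (intervalIntegrable_comp h₁ hw _)
    (intervalIntegrable_comp h₂ hw _)]

/-- The trace asymptotics for convex Lipschitz functions. -/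
lemma tendsto_trFun_V_of_convex {σ : ℝ → ℝ} (hσ : Continuous σ)
    (hper : Function.Periodic σ (2 * π)) {f : ℝ → ℝ} (hf : ConvexOn ℝ univ f) {L : ℝ}
    (hL0 : 0 ≤ L) (hL : ∀ x y, |f x - f y| ≤ L * |x - y|) :
    Tendsto (fun ℓ : ℕ => 1 / ((ℓ : ℂ) + 1) * trFun f (V ℓ hσ)) atTop
      (𝓝 (limitValue f σ : ℂ)) := by
  have h1 := (tendsto_average_eigenvalues hf hL0 hL (continuous_evenPart hσ)
    (periodic_evenPart hper)).comp (tendsto_add_atTop_nat 1)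
  have h2 := (Complex.continuous_ofReal.tendsto _).comp h1
  rw [limitValue_eq_symbolMean]
  refine h2.congr fun ℓ => ?_
  rw [trFun_V hσ hper]
  simp only [Function.comp_apply]
  push_cast
  ring

lemma trFun_sub {E : Type*} [NormedAddCommGroup E] [InnerProductSpace ℂ E]
    [CompleteSpace E] {T : E →L[ℂ] E} {f₁ f₂ : ℝ → ℝ} (h₁ : Continuous f₁) (h₂ : Continuous f₂) :
    trFun (fun x => f₁ x - f₂ x) T = trFun f₁ T - trFun f₂ T := by
  rw [trFun, cfc_sub f₁ f₂ T h₁.continuousOn h₂.continuousOn, ContinuousLinearMap.toLinearMap_sub,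
    map_sub]
  rfl

/-- The trace asymptotics for differences of convex Lipschitz functions. -/
lemma tendsto_trFun_V_of_sub {σ : ℝ → ℝ} (hσ : Continuous σ)
    (hper : Function.Periodic σ (2 * π)) {f₁ f₂ : ℝ → ℝ} (hf₁ : ConvexOn ℝ univ f₁)
    (hf₂ : ConvexOn ℝ univ f₂) {L₁ L₂ : ℝ} (h₁0 : 0 ≤ L₁) (h₂0 : 0 ≤ L₂)
    (h₁ : ∀ x y, |f₁ x - f₁ y| ≤ L₁ * |x - y|) (h₂ : ∀ x y, |f₂ x - f₂ y| ≤ L₂ * |x - y|) :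
    Tendsto (fun ℓ : ℕ => 1 / ((ℓ : ℂ) + 1) * trFun (fun x => f₁ x - f₂ x) (V ℓ hσ)) atTop
      (𝓝 (limitValue (fun x => f₁ x - f₂ x) σ : ℂ)) := by
  have h := (tendsto_trFun_V_of_convex hσ hper hf₁ h₁0 h₁).sub
    (tendsto_trFun_V_of_convex hσ hper hf₂ h₂0 h₂)
  rw [limitValue_eq_symbolMean, symbolMean_sub_of_lipschitz h₁ h₂ intervalIntegrable_profile
    (continuous_evenPart hσ), ← limitValue_eq_symbolMean, ← limitValue_eq_symbolMean,
    Complex.ofReal_sub]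
  refine h.congr fun ℓ => ?_
  rw [trFun_sub (continuous_of_abs_sub_le h₁) (continuous_of_abs_sub_le h₂), mul_sub]

/-! ### Smooth compactly supported functions as differences of convex Lipschitz functions -/

section Decomposition

lemma hasDerivAt_sqrt_one_add_sq (x : ℝ) :
    HasDerivAt (fun x : ℝ => √(1 + x ^ 2)) (x / √(1 + x ^ 2)) x := by
  have h : HasDerivAt (fun x : ℝ => 1 + x ^ 2) (2 * x) x := by
    simpa using (hasDerivAt_pow 2 x).const_add 1
  convert h.sqrt (by positivity) using 1
  field_simp

lemma hasDerivAt_div_sqrt_one_add_sq (x : ℝ) :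
    HasDerivAt (fun x : ℝ => x / √(1 + x ^ 2)) (1 / (√(1 + x ^ 2) * (1 + x ^ 2))) x := by
  have h0 : 0 < √(1 + x ^ 2) := by positivity
  have h := (hasDerivAt_id x).div (hasDerivAt_sqrt_one_add_sq x) h0.ne'
  have h1 : √(1 + x ^ 2) ^ 2 = 1 + x ^ 2 := Real.sq_sqrt (by positivity)
  refine h.congr_deriv ?_
  simp only [id]
  rw [h1]
  field_simp
  rw [h1]
  ring

/-- `√(1+x²)` is the modulus of `1 + ix`, so this is the reverse triangle inequality. -/
lemma abs_sqrt_one_add_sq_sub_le (x y : ℝ) : |√(1 + x ^ 2) - √(1 + y ^ 2)| ≤ |x - y| := by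
  have h : ∀ x : ℝ, √(1 + x ^ 2) = ‖((1 : ℝ) : ℂ) + x * Complex.I‖ := fun x => by
    rw [Complex.norm_add_mul_I, one_pow]
  rw [h, h]
  refine (abs_norm_sub_norm_le _ _).trans (le_of_eq ?_)
  rw [add_sub_add_left_eq_sub, ← sub_mul, norm_mul, Complex.norm_I, mul_one, ← Complex.ofReal_sub,
    Complex.norm_real, Real.norm_eq_abs]

/-- If `|f''| ≤ M (1+x²)^{-3/2}` then `M √(1+x²) + f` is convex. -/
lemma convexOn_sqrt_add {f : ℝ → ℝ} (hf : ContDiff ℝ 2 f) {M : ℝ}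
    (hM : ∀ x, |deriv (deriv f) x * (√(1 + x ^ 2) * (1 + x ^ 2))| ≤ M) :
    ConvexOn ℝ univ fun x => M * √(1 + x ^ 2) + f x := by
  have hf1 : Differentiable ℝ f := hf.differentiable two_ne_zero
  have hf2 : Differentiable ℝ (deriv f) := by
    have : ContDiff ℝ 1 (deriv f) := ((contDiff_succ_iff_deriv (n := 1)).1 hf).2.2
    exact this.differentiable one_ne_zero
  have hd : ∀ x, HasDerivAt (fun x => M * √(1 + x ^ 2) + f x)
      (M * (x / √(1 + x ^ 2)) + deriv f x) x := fun x =>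
    ((hasDerivAt_sqrt_one_add_sq x).const_mul M).add (hf1 x).hasDerivAt
  have hd2 : ∀ x, HasDerivAt (fun x => M * (x / √(1 + x ^ 2)) + deriv f x)
      (M * (1 / (√(1 + x ^ 2) * (1 + x ^ 2))) + deriv (deriv f) x) x := fun x =>
    ((hasDerivAt_div_sqrt_one_add_sq x).const_mul M).add (hf2 x).hasDerivAt
  have hderiv : deriv (fun x => M * √(1 + x ^ 2) + f x) =
      fun x => M * (x / √(1 + x ^ 2)) + deriv f x := funext fun x => (hd x).deriv
  refine convexOn_univ_of_deriv2_nonneg (fun x => (hd x).differentiableAt) ?_ fun x => ?_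
  · rw [hderiv]
    exact fun x => (hd2 x).differentiableAt
  · rw [Function.iterate_succ_apply, Function.iterate_one, hderiv, (hd2 x).deriv]
    have h0 : 0 < √(1 + x ^ 2) * (1 + x ^ 2) := by positivity
    have h1 := (abs_le.1 (hM x)).1
    have h2 : 0 ≤ (M + deriv (deriv f) x * (√(1 + x ^ 2) * (1 + x ^ 2))) /
        (√(1 + x ^ 2) * (1 + x ^ 2)) := div_nonneg (by linarith) h0.le
    rw [add_div, mul_div_cancel_right₀ _ h0.ne'] at h2
    rwa [mul_one_div]

end Decomposition

/-- The trace asymptotics for compactly supported `C²` functions. -/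
lemma tendsto_trFun_V_of_hasCompactSupport {σ : ℝ → ℝ} (hσ : Continuous σ)
    (hper : Function.Periodic σ (2 * π)) {f : ℝ → ℝ} (hf : ContDiff ℝ 2 f)
    (hsupp : HasCompactSupport f) :
    Tendsto (fun ℓ : ℕ => 1 / ((ℓ : ℂ) + 1) * trFun f (V ℓ hσ)) atTop
      (𝓝 (limitValue f σ : ℂ)) := by
  have hf2 : Continuous (deriv (deriv f)) := by
    have : ContDiff ℝ 1 (deriv f) := ((contDiff_succ_iff_deriv (n := 1)).1 hf).2.2
    exact this.continuous_deriv le_rfl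
  -- `f'' (1+x²)^{3/2}` is continuous with compact support, hence bounded; the factor is the
  -- reciprocal of the second derivative of `√(1+x²)`.
  obtain ⟨M, hM⟩ := (hsupp.deriv.deriv.mul_right
    (f' := fun x : ℝ => √(1 + x ^ 2) * (1 + x ^ 2))).exists_bound_of_continuous (by fun_prop)
  have hM0 : 0 ≤ M := (norm_nonneg _).trans (hM 0)
  obtain ⟨C, hC⟩ := hf.lipschitzWith_of_hasCompactSupport hsupp two_ne_zero
  have hzero : ConvexOn ℝ univ fun x : ℝ => M * √(1 + x ^ 2) := by
    have := convexOn_sqrt_add (f := fun _ => 0) contDiff_const (M := M) (by simpa using hM0)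
    simpa using this
  have h2 : ∀ x y : ℝ, |M * √(1 + x ^ 2) - M * √(1 + y ^ 2)| ≤ M * |x - y| := fun x y => by
    rw [← mul_sub, abs_mul, abs_of_nonneg hM0]
    exact mul_le_mul_of_nonneg_left (abs_sqrt_one_add_sq_sub_le x y) hM0
  have h1 : ∀ x y : ℝ, |(M * √(1 + x ^ 2) + f x) - (M * √(1 + y ^ 2) + f y)| ≤
      (M + C) * |x - y| := fun x y => by
    have h3 := hC.dist_le_mul x y
    rw [Real.dist_eq, Real.dist_eq] at h3
    rw [add_sub_add_comm, add_mul]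
    exact (abs_add_le _ _).trans (add_le_add (h2 x y) h3)
  have h := tendsto_trFun_V_of_sub hσ hper (convexOn_sqrt_add hf hM) hzero (by positivity) hM0 h1 h2
  simpa only [add_sub_cancel_left] using h

end Hemisphere

theorem theorem2p1 (σ : ℝ → ℝ) (hσ : ContDiff ℝ 1 σ) (hper : Function.Periodic σ (2 * π)) :
    (∀ f : ℝ → ℝ, ContDiff ℝ ∞ f → HasCompactSupport f → f 0 = 0 →
      Tendsto (fun ℓ : ℕ => 1 / ((ℓ : ℂ) + 1) *
        Hemisphere.trFun f (Hemisphere.V ℓ hσ.continuous)) atTop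
        (𝓝 (Hemisphere.limitValue f σ : ℂ))) ∧
    Tendsto (fun ℓ : ℕ => 1 / ((ℓ : ℂ) + 1) *
      Hemisphere.trFun (fun x => x) (Hemisphere.V ℓ hσ.continuous)) atTop
      (𝓝 (Hemisphere.limitValue (fun x => x) σ : ℂ)) := by
  refine ⟨fun f hf hsupp _ => ?_, ?_⟩
  · exact Hemisphere.tendsto_trFun_V_of_hasCompactSupport hσ.continuous hper
      (contDiff_infty.1 hf 2) hsupp
  · exact Hemisphere.tendsto_trFun_V_of_convex hσ.continuous hper (convexOn_id convex_univ)
      zero_le_one (fun x y => by simp)
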